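/- Let $\mathcal G$ be a compact connected metric graph: finitely many edges (at least one), each edge $e$ identified with an interval $[0,\ell_e]$, $0<\ell_e<\infty$, with endpoints glued together at vertices (self-loops and multiple edges allowed). Let $|\mathcal G|=\sum_e \ell_e$. Let $H^1(\mathcal G)$ be the space of functions $u:\mathcal G\to\mathbb C$ that are continuous on $\mathcal G$ and of class $H^1$ on every edge, with norm $\|u'\|_2+\|u\|_2$. For $\mu>0$ put $H^1_\mu(\mathcal G)=\{u\in H^1(\mathcal G):\|u\|_2^2=\mu\}$, let $\kappa_\mu\equiv\sqrt{\mu/|\mathcal G|}$ be the constant function of mass $\mu$, and for $p\in(2,6]$ let $$E(u)=\frac12\int_{\mathcal G}|u'|^2\,dx-\frac1p\int_{\mathcal G}|u|^p\,dx .$$ Let $$\lambda_2(\mathcal G)=\inf\Big\{\frac{\int_{\mathcal G}|\varphi'|^2\,dx}{\int_{\mathcal G}|\varphi|^2\,dx} : \varphi\in H^1(\mathcal G)\setminus\{0\},\ \int_{\mathcal G}\varphi\,dx=0\Big\},\qquad \mu_1(\mathcal G,p)=|\mathcal G|\Big(\frac{\lambda_2(\mathcal G)}{p-2}\Big)^{\frac{2}{p-2}}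 .$$ Let $p=6$. Then $\mu_1(\mathcal G,6)$ is positive and is the threshold for local minimality of the constants: $\kappa_\mu$ is a local minimizer of $E$ in $H^1_\mu(\mathcal G)$ for every $0<\mu<\mu_1(\mathcal G,6)$, and is not a local minimizer of $E$ in $H^1_\mu(\mathcal G)$ for any $\mu>\mu_1(\mathcal G,6)$. Moreover, for every such $\mathcal G$, $$\mu_1(\mathcal G,6)\ \ge\ \frac{\pi}{2},$$ and, if $\mathcal G$ admits a cycle covering (every edge belongs to a cycle, i.e. to a closed path that traverses no edge twice), then $$\mu_1(\mathcal G,6)\ \ge\ \pi .$$ -/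

import Mathlib

noncomputable section

/-- A compact connected metric graph with vertex set `V` and finite edge set `E`. The edge `e` is
identified with the interval `[0, len e]`, its endpoint `0` being glued to the vertex `src e` and
its endpoint `len e` to the vertex `tgt e`. Self-loops and multiple edges are allowed; the
orientation of the edges only fixes the coordinates. -/
structure MetricGraph (V E : Type*) where
  src : E → V
  tgt : E → V
  len : E → ℝ
  len_pos : ∀ e, 0 < len e
  connected : ∀ v w : V,
    Relation.EqvGen (fun a b => ∃ e, src e = a ∧ tgt e = b) v w

namespace MetricGraph

variable {V E : Type*} (G : MetricGraph V E)

/-- Initial vertex of the edge `d.1`, traversed in the direction of its coordinate if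
`d.2 = true` and in the opposite direction otherwise. -/
def tail (d : E × Bool) : V := if d.2 then G.src d.1 else G.tgt d.1

/-- Final vertex of the edge `d.1`, traversed in the direction of its coordinate if
`d.2 = true` and in the opposite direction otherwise. -/
def head (d : E × Bool) : V := if d.2 then G.tgt d.1 else G.src d.1

/-- `d 0, …, d n` is a closed path without repetition of edges. The index `i + 1` is taken
cyclically in `Fin (n + 1)`, so the path closes up. -/
def IsCycle {n : ℕ} (d : Fin (n + 1) → E × Bool) : Prop :=
  Function.Injective (fun i => (d i).1) ∧ ∀ i, G.head (d i) = G.tail (d (i + 1))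

/-- The graph is covered by cycles: every edge belongs to a cycle. -/
def HasCycleCovering : Prop :=
  ∀ e : E, ∃ (n : ℕ) (d : Fin (n + 1) → E × Bool), G.IsCycle d ∧ ∃ i, (d i).1 = e

/-- A function on the graph is given by its restrictions `u e` to the edges; only the values of
`u e` on `[0, len e]` matter. It belongs to `H¹(G)` if each `u e` is in `H¹(0, len e)`
(absolutely continuous on `[0, len e]` with square integrable derivative) and `u` is continuous at
the vertices, i.e. the values at all edge endpoints glued to a vertex `v` agree (with `c v`). -/
def MemH1 (u : E → ℝ → ℂ) : Prop :=
  (∀ e, AbsolutelyContinuousOnInterval (u e) 0 (G.len e) ∧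
    MeasureTheory.MemLp (deriv (u e)) 2
      (MeasureTheory.volume.restrict (Set.Ioc 0 (G.len e)))) ∧
  ∃ c : V → ℂ, ∀ e, u e 0 = c (G.src e) ∧ u e (G.len e) = c (G.tgt e)

variable [Fintype E]

/-- Total length `|G|`. -/
def length : ℝ := ∑ e, G.len e

/-- `∫_G u dx`. -/
def integral {F : Type*} [NormedAddCommGroup F] [NormedSpace ℝ F] (u : E → ℝ → F) : F :=
  ∑ e, ∫ x in (0 : ℝ)..G.len e, u e x

/-- The mass `‖u‖₂²`. -/
def mass (u : E → ℝ → ℂ) : ℝ := G.integral fun e x => ‖u e x‖ ^ 2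

/-- `‖u'‖₂²`. -/
def dirichlet (u : E → ℝ → ℂ) : ℝ := G.integral fun e x => ‖deriv (u e) x‖ ^ 2

/-- `‖u‖_{H¹} = ‖u'‖₂ + ‖u‖₂`. -/
def normH1 (u : E → ℝ → ℂ) : ℝ := √(G.dirichlet u) + √(G.mass u)

/-- The energy `E(u) = ½ ‖u'‖₂² - (1/p) ‖u‖_p^p`. -/
def energy (p : ℝ) (u : E → ℝ → ℂ) : ℝ :=
  1 / 2 * G.dirichlet u - 1 / p * G.integral fun e x => ‖u e x‖ ^ p

/-- `u` lies in `H¹_μ(G) = {u ∈ H¹(G) : ‖u‖₂² = μ}`. -/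
def MemH1Mass (μ : ℝ) (u : E → ℝ → ℂ) : Prop := G.MemH1 u ∧ G.mass u = μ

/-- `u` is a local minimizer of the energy in `H¹_μ(G)`. -/
def IsLocalMinimizer (p μ : ℝ) (u : E → ℝ → ℂ) : Prop :=
  G.MemH1Mass μ u ∧ ∃ δ > 0, ∀ v : E → ℝ → ℂ,
    G.MemH1Mass μ v → G.normH1 (v - u) < δ → G.energy p u ≤ G.energy p v

/-- The constant function `κ_μ = √(μ / |G|)`. -/
def kappa (μ : ℝ) : E → ℝ → ℂ := fun _ _ => ((√(μ / G.length) : ℝ) : ℂ)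

/-- `m` is the mass threshold for local minimality of the constant functions. -/
def IsThreshold (p m : ℝ) : Prop :=
  0 < m ∧ (∀ μ, 0 < μ → μ < m → G.IsLocalMinimizer p μ (G.kappa μ)) ∧
    ∀ μ, m < μ → ¬ G.IsLocalMinimizer p μ (G.kappa μ)

/-- The smallest positive eigenvalue of the Kirchhoff Laplacian,
`λ₂(G) = inf {‖φ'‖₂² / ‖φ‖₂² : φ ∈ H¹(G) \ {0}, ∫_G φ dx = 0}`. -/
def lambda2 : ℝ :=
  sInf {r | ∃ φ : E → ℝ → ℂ, G.MemH1 φ ∧ G.mass φ ≠ 0 ∧ G.integral φ = 0 ∧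
    r = G.dirichlet φ / G.mass φ}

/-- `μ₁(G, p) = |G| (λ₂(G) / (p - 2)) ^ (2 / (p - 2))`. -/
def mu1 (p : ℝ) : ℝ := G.length * (G.lambda2 / (p - 2)) ^ (2 / (p - 2))

end MetricGraph

end

/-! At p = 6 the number `mu1` equals |G| √λ₂ / 2. With K² = μ/|G|, the quadratic part of the energy
at the constant K, along real zero-mean r with the mass kept fixed, is ½(∫|r'|² - 4K⁴ ∫r²). It
changes sign exactly when 4K⁴ = λ₂, i.e. when μ = `mu1`. Below the threshold, write a competitor as
v = a + w with a its mean. Mass conservation ties |a|² to the mass of w, the sextic term is expanded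
around |a|² with an error controlled by sup |w|, and λ₂ bounds the Dirichlet integral from below
(`isLocalMinimizer_kappa`). Above it, a zero-mean r with Rayleigh quotient below 4K⁴ gives a curve
b(s) + s r of mass μ along which the energy drops (`not_isLocalMinimizer_kappa`). The bounds on
`mu1` are λ₂ ≥ (2π/|G|)² for graphs covered by cycles and λ₂ ≥ (π/|G|)² in general. The first is
proved by a discrete substitute for rearrangement. Sample u along the edges with about k points per
unit length. Some closed trail contains an edge where the sampled minimum is attained and an edge
where the maximum is attained (`HasCycleCovering.exists_common`). Reading the samples along it gives
a closed list, and every other sample lies between two consecutive entries of that list, so it can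
be inserted without increasing the sum of squared increments (`List.exists_insert_list_sqVar_le`).
The result is a function on a discrete cycle with the same sums, to which the discrete Wirtinger
inequality `ZMod.wirtinger` applies; then k → ∞. For a general graph, doubling every edge produces a
cycle covering at the cost of doubling the length. -/

/-! ### Fourier analysis on ZMod N and the discrete Wirtinger inequality. -/

open Finset ZMod in
-- Parseval: expanding one factor and exchanging the sums leaves the double transform at -j, which
-- is N Φ(j).
theorem ZMod.sum_norm_dft_sq {N : ℕ} [NeZero N] (Φ : ZMod N → ℂ) :
    ∑ k, ‖ZMod.dft Φ k‖ ^ 2 = N * ∑ j, ‖Φ j‖ ^ 2 := by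
  have h : ∑ k, (starRingEnd ℂ) (ZMod.dft Φ k) * ZMod.dft Φ k
      = N * ∑ j, (starRingEnd ℂ) (Φ j) * Φ j := by
    have h1 : ∀ k, (starRingEnd ℂ) (ZMod.dft Φ k) * ZMod.dft Φ k
        = ∑ j, (starRingEnd ℂ) (Φ j) * (stdAddChar (-(k * (-j))) * ZMod.dft Φ k) := by
      intro k
      conv_lhs => rw [ZMod.dft_apply Φ k]
      rw [map_sum, Finset.sum_mul]
      refine Finset.sum_congr rfl fun j _ => ?_
      rw [smul_eq_mul, map_mul, ← AddChar.map_neg_eq_conj, ZMod.dft_apply]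
      rw [show -(-(j * k)) = -(k * -j) by ring]
      ring
    simp_rw [h1]
    rw [Finset.sum_comm, Finset.mul_sum]
    refine Finset.sum_congr rfl fun j _ => ?_
    rw [← Finset.mul_sum]
    have := congr_fun (ZMod.dft_dft Φ) (-j)
    rw [ZMod.dft_apply] at this
    simp only [smul_eq_mul, neg_neg] at this
    rw [this]; ring
  have h2 : ∀ z : ℂ, (starRingEnd ℂ) z * z = ((‖z‖ ^ 2 : ℝ) : ℂ) := by
    intro z
    rw [Complex.conj_mul']; push_cast; rfl
  simp_rw [h2] at h
  exact_mod_cast h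

open Finset ZMod in
theorem ZMod.dft_comp_add_one {N : ℕ} [NeZero N] (Φ : ZMod N → ℂ) (k : ZMod N) :
    ZMod.dft (fun j => Φ (j + 1)) k = stdAddChar k * ZMod.dft Φ k := by
  rw [ZMod.dft_apply, ZMod.dft_apply, Finset.mul_sum]
  refine Fintype.sum_equiv (Equiv.addRight 1) _ _ fun j => ?_
  simp only [Equiv.coe_addRight, smul_eq_mul]
  rw [← mul_assoc, ← AddChar.map_add_eq_mul]
  congr 2; ring

/-- Sine increases up to π/2 and is symmetric about it. This identifies the lowest nonconstant
frequency on the discrete cycle. -/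
theorem Real.sin_pi_div_le_sin_mul_div {N k : ℕ} (hk : 1 ≤ k) (hkN : k < N) :
    Real.sin (Real.pi / N) ≤ Real.sin (Real.pi * k / N) := by
  have hN : (0 : ℝ) < N := by exact_mod_cast (by omega : 0 < N)
  have hk1 : (1 : ℝ) ≤ k := by exact_mod_cast hk
  have hk2 : (k : ℝ) + 1 ≤ N := by exact_mod_cast hkN
  have hpi := Real.pi_pos
  have h0 : 0 ≤ Real.pi / N := by positivity
  rcases le_total (2 * (k : ℝ)) N with h | h
  · refine Real.sin_le_sin_of_le_of_le_pi_div_two (by linarith) ?_ ?_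
    · rw [div_le_div_iff₀ hN two_pos]; nlinarith
    · gcongr; nlinarith
  · rw [← Real.sin_pi_sub (Real.pi * k / N)]
    refine Real.sin_le_sin_of_le_of_le_pi_div_two (by linarith) ?_ ?_
    · rw [sub_le_iff_le_add, ← sub_le_iff_le_add', le_div_iff₀ hN]
      nlinarith
    · rw [le_sub_iff_add_le, ← add_div, div_le_iff₀ hN]
      nlinarith

open Finset ZMod in
theorem ZMod.norm_stdAddChar_sub_one {N : ℕ} [NeZero N] (k : ZMod N) :
    ‖(stdAddChar k : ℂ) - 1‖ = 2 * |Real.sin (Real.pi * k.val / N)| := by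
  have h : (stdAddChar k : ℂ) = Complex.exp (Complex.I * ((2 * Real.pi * k.val / N : ℝ) : ℂ)) := by
    have := ZMod.stdAddChar_coe (N := N) (k.val : ℤ)
    rw [Int.cast_natCast, ZMod.natCast_zmod_val] at this
    rw [this]
    congr 1; push_cast; ring
  rw [h, Complex.norm_exp_I_mul_ofReal_sub_one, norm_mul, Real.norm_eq_abs, Real.norm_eq_abs,
    abs_two]
  congr 3; ring

/-- The discrete Wirtinger inequality on a cycle. -/
theorem ZMod.wirtinger {N : ℕ} [NeZero N] (z : ZMod N → ℝ) :
    4 * Real.sin (Real.pi / N) ^ 2 * (∑ i, z i ^ 2 - (∑ i, z i) ^ 2 / N)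
      ≤ ∑ i, (z (i + 1) - z i) ^ 2 := by
  have hN : (0 : ℝ) < N := by exact_mod_cast NeZero.pos N
  set Φ : ZMod N → ℂ := fun j => z j with hΦ
  have p1 := ZMod.sum_norm_dft_sq Φ
  have p2 := ZMod.sum_norm_dft_sq (fun j => Φ (j + 1) - Φ j)
  have e1 : ∀ j, ‖Φ j‖ ^ 2 = z j ^ 2 := fun j => by simp [hΦ]
  have e2 : ∀ j, ‖Φ (j + 1) - Φ j‖ ^ 2 = (z (j + 1) - z j) ^ 2 := fun j => by
    simp only [hΦ]; rw [← Complex.ofReal_sub, Complex.norm_real, Real.norm_eq_abs, sq_abs]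
  have e3 : ∀ k, ‖ZMod.dft (fun j => Φ (j + 1) - Φ j) k‖ ^ 2
      = (2 * |Real.sin (Real.pi * k.val / N)|) ^ 2 * ‖ZMod.dft Φ k‖ ^ 2 := fun k => by
    have : (fun j => Φ (j + 1) - Φ j) = (fun j => Φ (j + 1)) - Φ := rfl
    rw [this, map_sub, Pi.sub_apply, ZMod.dft_comp_add_one, ← sub_one_mul, norm_mul, mul_pow,
      ZMod.norm_stdAddChar_sub_one]
  have e4 : ‖ZMod.dft Φ 0‖ ^ 2 = (∑ i, z i) ^ 2 := by
    rw [ZMod.dft_apply_zero, hΦ, ← Complex.ofReal_sum, Complex.norm_real, Real.norm_eq_abs, sq_abs]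
  simp_rw [e1] at p1
  simp_rw [e2, e3] at p2
  -- On the Fourier side the zero mode is removed, and every other mode has multiplier at least 4
  -- sin²(π/N).
  have key : 4 * Real.sin (Real.pi / N) ^ 2 * (∑ k, ‖ZMod.dft Φ k‖ ^ 2 - ‖ZMod.dft Φ 0‖ ^ 2)
      ≤ ∑ k : ZMod N, (2 * |Real.sin (Real.pi * k.val / N)|) ^ 2 * ‖ZMod.dft Φ k‖ ^ 2 := by
    rw [← Finset.add_sum_erase _ _ (Finset.mem_univ (0 : ZMod N)),
      ← Finset.add_sum_erase _ (fun k : ZMod N => (2 * |Real.sin (Real.pi * k.val / N)|) ^ 2 *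
        ‖ZMod.dft Φ k‖ ^ 2) (Finset.mem_univ (0 : ZMod N))]
    simp only [ZMod.val_zero, Nat.cast_zero, mul_zero, zero_div, Real.sin_zero, abs_zero,
      add_sub_cancel_left, ne_eq, OfNat.ofNat_ne_zero, not_false_eq_true, zero_pow, zero_mul,
      zero_add]
    rw [Finset.mul_sum]
    refine Finset.sum_le_sum fun k hk => ?_
    have hk0 : k ≠ 0 := (Finset.mem_erase.1 hk).1
    have hk1 : 1 ≤ k.val := by
      have := (ZMod.val_eq_zero k).not.2 hk0
      omega
    have := Real.sin_pi_div_le_sin_mul_div hk1 (ZMod.val_lt k)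
    have h0 : 0 ≤ Real.sin (Real.pi / N) := by
      refine Real.sin_nonneg_of_nonneg_of_le_pi (by positivity) ?_
      refine div_le_self Real.pi_pos.le ?_
      exact_mod_cast NeZero.one_le
    rw [mul_pow, sq_abs]
    gcongr
    norm_num
  rw [p1, p2, e4] at key
  refine le_of_mul_le_mul_left ?_ hN
  refine le_trans (le_of_eq ?_) key
  field_simp

/-! ### Squared variation of lists and insertion of intermediate values. -/

/-- Sum of the squared increments along a list. -/
def List.sqVar : List ℝ → ℝ
  | [] => 0
  | [_] => 0
  | a :: b :: l => (a - b) ^ 2 + List.sqVar (b :: l)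

namespace List

theorem sqVar_append_cons : ∀ (l m : List ℝ) (x : ℝ), l.getLast? = some x →
    (l ++ x :: m).sqVar = l.sqVar + (x :: m).sqVar
  | [], _, _, h => by simp at h
  | [a], m, x, h => by
    obtain rfl : a = x := by simpa using h
    simp [sqVar]
  | a :: b :: l, m, x, h => by
    have := sqVar_append_cons (b :: l) m x (by simpa using h)
    simp only [cons_append, sqVar] at this ⊢
    rw [this]; ring

theorem sqVar_concat_concat : ∀ (l : List ℝ) (a b : ℝ),
    (l ++ [a] ++ [b]).sqVar = (l ++ [a]).sqVar + (a - b) ^ 2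
  | [], a, b => by simp [sqVar]
  | [c], a, b => by simp [sqVar]
  | c :: d :: l, a, b => by
    have := sqVar_concat_concat (d :: l) a b
    simp only [cons_append, sqVar] at this ⊢
    rw [this]; ring

theorem sqVar_reverse : ∀ l : List ℝ, l.reverse.sqVar = l.sqVar
  | [] => rfl
  | [_] => rfl
  | a :: b :: l => by
    have := sqVar_reverse (b :: l)
    rw [reverse_cons] at this
    rw [reverse_cons, reverse_cons, sqVar_concat_concat, this, sqVar]; ring

theorem sqVar_nonneg : ∀ l : List ℝ, 0 ≤ l.sqVar
  | [] => le_rfl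
  | [_] => le_rfl
  | _ :: b :: l => add_nonneg (sq_nonneg _) (sqVar_nonneg (b :: l))

/-- Inserting between two consecutive entries a value lying between them decreases `sqVar`. -/
theorem exists_insert_sqVar_le (t b : ℝ) : ∀ (l : List ℝ) (a : ℝ),
    (a ≤ t ∧ ∃ y ∈ l ++ [b], t ≤ y) ∨ (t ≤ a ∧ ∃ y ∈ l ++ [b], y ≤ t) →
    ∃ l' : List ℝ, l'.Perm (t :: l) ∧ (a :: l' ++ [b]).sqVar ≤ (a :: l ++ [b]).sqVar
  | [], a, h => by
    refine ⟨[t], Perm.refl _, ?_⟩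
    simp only [nil_append, mem_singleton, exists_eq_left] at h
    simp only [cons_append, nil_append, sqVar]
    -- If t lies between a and b, the cross term 2(a - t)(t - b) in the expansion of (a - b)² is
    -- nonnegative.
    rcases h with h | h <;> nlinarith [mul_nonneg (sub_nonneg.2 h.1) (sub_nonneg.2 h.2)]
  | x :: l, a, h => by
    by_cases hx : (a ≤ t ∧ t ≤ x) ∨ (t ≤ a ∧ x ≤ t)
    · refine ⟨t :: x :: l, Perm.refl _, ?_⟩
      simp only [cons_append, sqVar]
      rcases hx with h | h <;> nlinarith [mul_nonneg (sub_nonneg.2 h.1) (sub_nonneg.2 h.2)]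
    -- No crossing of t occurs between a and x, so x is on the same side of t as a and the crossing
    -- comes later.
    · obtain ⟨l', hp, hl'⟩ := exists_insert_sqVar_le t b l x (by
        simp only [cons_append, mem_cons, exists_eq_or_imp] at h
        grind)
      refine ⟨x :: l', ((hp.cons x).trans (Perm.swap _ _ _)), ?_⟩
      simp only [cons_append, sqVar] at hl' ⊢
      linarith

/-- Values between the minimum and the maximum of a closed list can be inserted in it without
increasing `sqVar`. -/
theorem exists_insert_list_sqVar_le (a p q : ℝ) : ∀ (r l : List ℝ), p ∈ a :: l → q ∈ a :: l →
    (∀ t ∈ r, p ≤ t ∧ t ≤ q) →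
    ∃ l' : List ℝ, l'.Perm (r ++ l) ∧ (a :: l' ++ [a]).sqVar ≤ (a :: l ++ [a]).sqVar
  | [], l, _, _, _ => ⟨l, Perm.refl _, le_rfl⟩
  | t :: r, l, hp, hq, h => by
    have ht := h t mem_cons_self
    obtain ⟨l₁, hp₁, h₁⟩ := exists_insert_sqVar_le t a l a (by
      rcases le_total a t with hat | hat
      · refine Or.inl ⟨hat, q, ?_, ht.2⟩
        rcases mem_cons.1 hq with rfl | hq <;> simp_all
      · refine Or.inr ⟨hat, p, ?_, ht.1⟩
        rcases mem_cons.1 hp with rfl | hp <;> simp_all)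
    have hsub : ∀ x ∈ a :: l, x ∈ a :: l₁ := fun x hx => by
      rcases mem_cons.1 hx with rfl | hx
      · exact mem_cons_self
      · exact mem_cons_of_mem _ (hp₁.mem_iff.2 (mem_cons_of_mem _ hx))
    obtain ⟨l', hp', h'⟩ := exists_insert_list_sqVar_le a p q r l₁ (hsub p hp) (hsub q hq)
      fun s hs => h s (mem_cons_of_mem _ hs)
    exact ⟨l', hp'.trans ((hp₁.append_left r).trans perm_middle), h'.trans h₁⟩

theorem sqVar_eq_sum : ∀ (l : List ℝ) (a b : ℝ), (a :: l ++ [b]).sqVar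
    = ∑ i : Fin (l.length + 1), ((l ++ [b])[i]'(by simp; omega) - (a :: l)[i]) ^ 2
  | [], a, b => by simp [sqVar]; ring
  | x :: l, a, b => by
    have := sqVar_eq_sum l x b
    simp only [cons_append] at this
    rw [Fin.sum_univ_succ]
    simp only [cons_append, sqVar, this, length_cons]
    congr 1
    simp; ring

/-- The discrete Wirtinger inequality for a closed list. -/
theorem wirtinger (a : ℝ) (l : List ℝ) :
    4 * Real.sin (Real.pi / (a :: l).length) ^ 2 *
      (((a :: l).map (· ^ 2)).sum - (a :: l).sum ^ 2 / (a :: l).length)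
      ≤ (a :: l ++ [a]).sqVar := by
  have h := ZMod.wirtinger (N := l.length + 1) (fun i : Fin (l.length + 1) => (a :: l)[i])
  have e1 : ((a :: l).map (· ^ 2)).sum = ∑ i : Fin (l.length + 1), (a :: l)[i] ^ 2 := by
    rw [← Fin.sum_univ_getElem]
    simp only [List.getElem_map]
    exact Fintype.sum_equiv (finCongr (by simp)) _ _ fun i => by simp
  have e2 : (a :: l).sum = ∑ i : Fin (l.length + 1), (a :: l)[i] := (Fin.sum_univ_getElem _).symm
  rw [e1, e2, sqVar_eq_sum]
  refine h.trans (le_of_eq ?_)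
  -- `ZMod (n + 1)` unfolds to `Fin (n + 1)`, where `i + 1` wraps around; the final `a` of the
  -- closed list supplies the wrapped increment.
  change ∑ i : Fin (l.length + 1), ((a :: l)[(i + 1 : Fin (l.length + 1))] - (a :: l)[i]) ^ 2 = _
  refine Finset.sum_congr rfl fun i _ => ?_
  congr 2
  induction i using Fin.lastCases with
  | last => simp [Fin.last_add_one]
  | cast i =>
    simp [Fin.coeSucc_eq_succ]

end List

/-! ### Closed trails: in a graph covered by cycles any two edges share one. -/

namespace MetricGraph

variable {V E : Type*} (G : MetricGraph V E)

/-- `l` is a walk from `a` to `b`. -/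
def IsWalk : V → List (E × Bool) → V → Prop
  | a, [], b => a = b
  | a, d :: l, b => G.tail d = a ∧ IsWalk (G.head d) l b

/-- The dart traversed in the opposite direction. -/
def flip (d : E × Bool) : E × Bool := (d.1, !d.2)

/-- `l` is a closed walk based at `a` without repetition of edges. -/
def IsClosedTrail (a : V) (l : List (E × Bool)) : Prop := G.IsWalk a l a ∧ (l.map Prod.fst).Nodup

variable {G}

theorem tail_flip (d : E × Bool) : G.tail (flip d) = G.head d := by
  rcases d with ⟨e, _ | _⟩ <;> simp [flip, tail, head]

theorem head_flip (d : E × Bool) : G.head (flip d) = G.tail d := by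
  rcases d with ⟨e, _ | _⟩ <;> simp [flip, tail, head]

theorem isWalk_append : ∀ {l m : List (E × Bool)} {a b : V},
    G.IsWalk a (l ++ m) b ↔ ∃ c, G.IsWalk a l c ∧ G.IsWalk c m b
  | [], m, a, b => by simp [IsWalk]
  | d :: l, m, a, b => by simp [IsWalk, isWalk_append, and_assoc]

theorem IsWalk.reverse : ∀ {l : List (E × Bool)} {a b : V}, G.IsWalk a l b →
    G.IsWalk b (l.map flip).reverse a
  | [], a, b, h => Eq.symm h
  | d :: l, a, b, h => by
    rw [List.map_cons, List.reverse_cons, isWalk_append]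
    exact ⟨_, IsWalk.reverse h.2, tail_flip d, (head_flip d).trans h.1⟩

theorem map_fst_reverse_flip (l : List (E × Bool)) :
    ((l.map flip).reverse.map Prod.fst) = (l.map Prod.fst).reverse := by
  simp [flip, Function.comp_def]

theorem IsClosedTrail.rotate {a c : V} {l m : List (E × Bool)} (h : G.IsClosedTrail a (l ++ m))
    (hl : G.IsWalk a l c) (hm : G.IsWalk c m a) : G.IsClosedTrail c (m ++ l) :=
  ⟨isWalk_append.2 ⟨_, hm, hl⟩, (List.perm_append_comm.map _).nodup_iff.1 h.2⟩

/-- A closed trail can be based at any endpoint of its edges. -/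
theorem IsClosedTrail.exists_rotate {a : V} {l : List (E × Bool)} (h : G.IsClosedTrail a l)
    {d : E × Bool} (hd : d ∈ l) {v : V} (hv : v = G.tail d ∨ v = G.head d) :
    ∃ l', l'.Perm l ∧ G.IsClosedTrail v l' := by
  obtain ⟨s, t, rfl⟩ := List.append_of_mem hd
  rcases hv with rfl | rfl
  · obtain ⟨c, h1, h2, h3⟩ := isWalk_append.1 h.1
    subst h2
    exact ⟨_, List.perm_append_comm, h.rotate h1 ⟨rfl, h3⟩⟩
  · have e : s ++ d :: t = (s ++ [d]) ++ t := by simp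
    rw [e] at h ⊢
    obtain ⟨c, h1, h2⟩ := isWalk_append.1 h.1
    obtain ⟨c', h3, h4, h5⟩ := isWalk_append.1 h1
    obtain rfl : G.head d = c := h5
    exact ⟨_, List.perm_append_comm, h.rotate h1 h2⟩

theorem IsWalk.exists_split {P : V → Prop} : ∀ {l : List (E × Bool)} {a b : V}, G.IsWalk a l b →
    P b → ∃ l₁ l₂ x, l = l₁ ++ l₂ ∧ G.IsWalk a l₁ x ∧ G.IsWalk x l₂ b ∧ P x ∧
      ∀ d ∈ l₁, ¬ P (G.tail d)
  | [], a, b, h, hb => ⟨[], [], b, rfl, h, rfl, hb, by simp⟩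
  | d :: l, a, b, h, hb => by
    by_cases ha : P a
    · exact ⟨[], d :: l, a, rfl, rfl, h, ha, by simp⟩
    · obtain ⟨l₁, l₂, x, e, h₁, h₂, hx, hP⟩ := IsWalk.exists_split h.2 hb
      refine ⟨d :: l₁, l₂, x, by rw [e]; rfl, ⟨h.1, h₁⟩, h₂, hx, ?_⟩
      intro d' hd'
      rcases List.mem_cons.1 hd' with rfl | hd'
      · rwa [h.1]
      · exact hP d' hd'

theorem IsWalk.exists_split_last {P : V → Prop} {l : List (E × Bool)} {a b : V}
    (h : G.IsWalk a l b) (ha : P a) :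
    ∃ l₁ l₂ x, l = l₁ ++ l₂ ∧ G.IsWalk a l₁ x ∧ G.IsWalk x l₂ b ∧ P x ∧
      ∀ d ∈ l₂, ¬ P (G.head d) := by
  have hff : ∀ m : List (E × Bool), ((m.map flip).reverse.map flip).reverse = m := fun m => by
    simp [Function.comp_def, flip]
  obtain ⟨l₁, l₂, x, e, h₁, h₂, hx, hP⟩ := h.reverse.exists_split ha
  refine ⟨(l₂.map flip).reverse, (l₁.map flip).reverse, x, ?_, h₂.reverse, h₁.reverse, hx, ?_⟩
  · rw [← List.reverse_append, ← List.map_append, ← e, hff]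
  · intro d hd
    simp only [List.mem_reverse, List.mem_map] at hd
    obtain ⟨d', hd', rfl⟩ := hd
    rw [head_flip]
    exact hP d' hd'

/-- If an edge `f` off a closed trail `t` belongs to a closed trail meeting `t`, then a closed
trail contains `f` and any given edge of `t`. -/
theorem IsClosedTrail.exists_of_meet {a c : V} {t u : List (E × Bool)} (ht : G.IsClosedTrail a t)
    (hu : G.IsClosedTrail c u) {d f p q : E × Bool} (hd : d ∈ t) (hf : f ∈ u)
    (hft : f.1 ∉ t.map Prod.fst) (hp : p ∈ t) (hq : q ∈ u) (hpq : G.tail q = G.tail p ∨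
      G.tail q = G.head p) :
    ∃ b l, G.IsClosedTrail b l ∧ d.1 ∈ l.map Prod.fst ∧ f.1 ∈ l.map Prod.fst := by
  obtain ⟨s, r, rfl⟩ := List.append_of_mem hf
  obtain ⟨c', h1, h2, h3⟩ := isWalk_append.1 hu.1
  have hv : G.IsClosedTrail (G.tail f) (f :: (r ++ s)) := by
    subst h2
    exact hu.rotate h1 ⟨rfl, h3⟩
  have hq' : q = f ∨ q ∈ r ++ s := by simp at hq ⊢; tauto
  obtain ⟨⟨-, hw⟩, hnd⟩ := hv
  generalize r ++ s = w at hw hnd hq'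
  -- `P` singles out the vertices of t. The aim is a piece Q of u through f that touches t only at
  -- its two ends; adding to Q one of the two arcs of t between these ends closes it up.
  set P : V → Prop := fun v => ∃ d ∈ t, v = G.tail d ∨ v = G.head d with hP
  have hPt : ∀ g : E × Bool, g.1 ∈ t.map Prod.fst → P (G.tail g) ∧ P (G.head g) := by
    intro g hg
    obtain ⟨g', hg', e⟩ := List.mem_map.1 hg
    have : g = g' ∨ g = flip g' := by
      rcases g with ⟨x, _ | _⟩ <;> rcases g' with ⟨y, _ | _⟩ <;> simp_all [flip]
    rcases this with rfl | rfl
    · exact ⟨⟨g, hg', Or.inl rfl⟩, ⟨g, hg', Or.inr rfl⟩⟩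
    · exact ⟨⟨g', hg', Or.inr (tail_flip _)⟩, ⟨g', hg', Or.inl (head_flip _)⟩⟩
  -- After f, follow u up to the first vertex x on t. When q = f the meeting vertex is the initial
  -- vertex of f, reached only at the end of w.
  obtain ⟨w₁, w₂, x, hx, rfl, hw₁x, hw₂x, hw₁P⟩ : ∃ w₁ w₂ x, P x ∧ w = w₁ ++ w₂ ∧
      G.IsWalk (G.head f) w₁ x ∧ G.IsWalk x w₂ (G.tail f) ∧ ∀ d ∈ w₁, ¬ P (G.tail d) := by
    rcases hq' with rfl | hq'
    · obtain ⟨w₁, w₂, x, k1, k2, k3, k4, k5⟩ := hw.exists_split (P := P) ⟨p, hp, hpq⟩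
      exact ⟨w₁, w₂, x, k4, k1, k2, k3, k5⟩
    · obtain ⟨w₃, w₄, rfl⟩ := List.append_of_mem hq'
      obtain ⟨y, m1, m2⟩ := isWalk_append.1 hw
      obtain ⟨w₁, w₂, x, k1, k2, k3, k4, k5⟩ := m1.exists_split (P := P) (by
        rw [← m2.1]; exact ⟨p, hp, hpq⟩)
      exact ⟨w₁, w₂ ++ q :: w₄, x, k4, by simp [k1], k2, isWalk_append.2 ⟨_, k3, m2⟩, k5⟩
  -- Going backwards from f, let y be the last vertex on t; the portion m between x and y is
  -- discarded.
  obtain ⟨m, w₃, y, rfl, hm, hw₃, hy, hw₃P⟩ := hw₂x.exists_split_last hx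
  have hQ : G.IsWalk y (w₃ ++ f :: w₁) x := isWalk_append.2 ⟨_, hw₃, rfl, hw₁x⟩
  have hQn : ((w₃ ++ f :: w₁).map Prod.fst).Nodup := by
    have hperm : (f :: (w₁ ++ (m ++ w₃))).Perm (m ++ (w₃ ++ f :: w₁)) := by
      have := List.perm_append_comm (l₁ := f :: w₁) (l₂ := m ++ w₃)
      rwa [List.append_assoc, List.cons_append] at this
    have := (hperm.map Prod.fst).nodup_iff.1 hnd
    rw [List.map_append] at this
    exact (List.nodup_append.1 this).2.1
  have hQt : ∀ e ∈ (w₃ ++ f :: w₁).map Prod.fst, e ∉ t.map Prod.fst := by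
    intro e he het
    obtain ⟨g, hg, rfl⟩ := List.mem_map.1 he
    have := hPt g het
    simp only [List.mem_append, List.mem_cons] at hg
    rcases hg with hg | rfl | hg
    · exact hw₃P g hg this.2
    · exact hft het
    · exact hw₁P g hg this.1
  have hfQ : f.1 ∈ (w₃ ++ f :: w₁).map Prod.fst := by simp
  obtain ⟨d', hd', hyd⟩ := hy
  obtain ⟨t', htp, ht'⟩ := ht.exists_rotate hd' hyd
  generalize w₃ ++ f :: w₁ = Q at *
  have htf : ∀ e, e ∈ t'.map Prod.fst ↔ e ∈ t.map Prod.fst := fun e => (htp.map _).mem_iff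
  simp_rw [← htf] at hQt
  have hdt : d.1 ∈ t'.map Prod.fst := (htf _).2 (List.mem_map_of_mem hd)
  obtain ⟨t₁, t₂, rfl, ht₁, ht₂⟩ : ∃ t₁ t₂, t' = t₁ ++ t₂ ∧ G.IsWalk y t₁ x ∧ G.IsWalk x t₂ y := by
    obtain ⟨g, hg, hgx⟩ := hx
    obtain ⟨s₁, s₂, rfl⟩ := List.append_of_mem (htp.mem_iff.2 hg)
    obtain ⟨z, k1, k2, k3⟩ := isWalk_append.1 ht'.1
    rcases hgx with rfl | rfl
    · subst k2
      exact ⟨s₁, g :: s₂, rfl, k1, rfl, k3⟩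
    · exact ⟨s₁ ++ [g], s₂, by simp, isWalk_append.2 ⟨_, k1, k2, rfl⟩, k3⟩
  have hn := ht'.2
  rw [List.map_append] at hn hdt hQt
  have hn1 := (List.nodup_append.1 hn)
  -- Keep the arc of t containing d. Q runs from y to x, so the arc t₁ from y to x must be reversed,
  -- while t₂ already returns from x to y.
  rcases List.mem_append.1 hdt with h | h
  · refine ⟨y, Q ++ (t₁.map flip).reverse, ⟨isWalk_append.2 ⟨_, hQ, ht₁.reverse⟩, ?_⟩, ?_, ?_⟩
    · rw [List.map_append, map_fst_reverse_flip, List.nodup_append]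
      refine ⟨hQn, List.nodup_reverse.2 hn1.1, ?_⟩
      rintro e he e' he' rfl
      exact hQt e he (List.mem_append_left _ (List.mem_reverse.1 he'))
    · rw [List.map_append, map_fst_reverse_flip]
      exact List.mem_append_right _ (List.mem_reverse.2 h)
    · rw [List.map_append]
      exact List.mem_append_left _ hfQ
  · refine ⟨y, Q ++ t₂, ⟨isWalk_append.2 ⟨_, hQ, ht₂⟩, ?_⟩, ?_, ?_⟩
    · rw [List.map_append, List.nodup_append]
      refine ⟨hQn, hn1.2.1, ?_⟩
      rintro e he e' he' rfl
      exact hQt e he (List.mem_append_right _ he')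
    · rw [List.map_append]
      exact List.mem_append_right _ h
    · rw [List.map_append]
      exact List.mem_append_left _ hfQ

theorem isWalk_map_range (f : ℕ → E × Bool) : ∀ n, (∀ i < n, G.head (f i) = G.tail (f (i + 1))) →
    G.IsWalk (G.tail (f 0)) ((List.range n).map f) (G.tail (f n))
  | 0, _ => rfl
  | n + 1, h => by
    rw [List.range_succ, List.map_append, isWalk_append]
    exact ⟨_, isWalk_map_range f n fun i hi => h i (by omega), rfl, h n (by omega)⟩

theorem IsCycle.exists_isClosedTrail {n : ℕ} {d : Fin (n + 1) → E × Bool} (h : G.IsCycle d) :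
    ∃ a l, G.IsClosedTrail a l ∧ ∀ i, d i ∈ l := by
  have hw := isWalk_map_range (G := G) (fun i => d (Fin.ofNat (n + 1) i)) (n + 1) fun i _ => by
    rw [h.2]; congr 2; ext; simp [Fin.val_add]
  have e : Fin.ofNat (n + 1) (n + 1) = Fin.ofNat (n + 1) 0 := by ext; simp
  rw [e] at hw
  refine ⟨_, _, ⟨hw, ?_⟩, fun i => List.mem_map.2 ⟨i, List.mem_range.2 i.2, by simp⟩⟩
  rw [List.map_map]
  refine List.Nodup.map_on (fun i hi j hj hij => ?_) List.nodup_range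
  have := h.1 hij
  have := congrArg Fin.val this
  rw [List.mem_range] at hi hj
  simpa [Nat.mod_eq_of_lt hi, Nat.mod_eq_of_lt hj] using this

theorem HasCycleCovering.exists_isClosedTrail (hG : G.HasCycleCovering) (e : E) :
    ∃ a l, G.IsClosedTrail a l ∧ e ∈ l.map Prod.fst := by
  obtain ⟨n, d, hd, i, rfl⟩ := hG e
  obtain ⟨a, l, hl, h⟩ := hd.exists_isClosedTrail
  exact ⟨a, l, hl, List.mem_map_of_mem (h i)⟩

/-- Each endpoint of an edge of a closed trail is the initial vertex of a dart of the trail. -/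
theorem IsClosedTrail.exists_tail_eq {a : V} {l : List (E × Bool)} (h : G.IsClosedTrail a l)
    {e : E} (he : e ∈ l.map Prod.fst) {v : V} (hv : v = G.src e ∨ v = G.tgt e) :
    ∃ q ∈ l, G.tail q = v := by
  obtain ⟨d, hd, rfl⟩ := List.mem_map.1 he
  have hv' : v = G.tail d ∨ v = G.head d := by
    rcases d with ⟨e, _ | _⟩ <;> simp [tail, head] at * <;> tauto
  obtain ⟨l', hp, hl'⟩ := h.exists_rotate hd hv'
  cases l' with
  | nil => simp [← hp.mem_iff] at hd
  | cons q l' => exact ⟨q, hp.mem_iff.1 List.mem_cons_self, hl'.1.1⟩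

/-- In a graph covered by cycles, any two edges belong to a common closed trail. -/
theorem HasCycleCovering.exists_common (hG : G.HasCycleCovering) (e f : E) :
    ∃ a l, G.IsClosedTrail a l ∧ e ∈ l.map Prod.fst ∧ f ∈ l.map Prod.fst := by
  set R : E → Prop := fun f => ∃ a l, G.IsClosedTrail a l ∧ e ∈ l.map Prod.fst ∧
    f ∈ l.map Prod.fst with hR
  -- Sharing a closed trail with e propagates to adjacent edges, hence to the whole graph by
  -- connectedness.
  have step : ∀ f g, R f → (∃ v, (v = G.src f ∨ v = G.tgt f) ∧ (v = G.src g ∨ v = G.tgt g)) →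
      R g := by
    rintro f g ⟨a, t, ht, het, hft⟩ ⟨v, hvf, hvg⟩
    by_cases hgt : g ∈ t.map Prod.fst
    · exact ⟨a, t, ht, het, hgt⟩
    obtain ⟨c, u, hu, hgu⟩ := hG.exists_isClosedTrail g
    obtain ⟨q, hq, hqv⟩ := hu.exists_tail_eq hgu hvg
    obtain ⟨p, hp, hpv⟩ := ht.exists_tail_eq hft hvf
    obtain ⟨d, hd, rfl⟩ := List.mem_map.1 het
    obtain ⟨k, hk, rfl⟩ := List.mem_map.1 hgu
    exact ht.exists_of_meet hu hd hk hgt hp hq (Or.inl (hqv.trans hpv.symm))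
  set S : V → Prop := fun v => ∃ g, R g ∧ (v = G.src g ∨ v = G.tgt g) with hS
  have hRS : ∀ g v, (v = G.src g ∨ v = G.tgt g) → S v → R g := by
    rintro g v hv ⟨g', hg', hv'⟩
    exact step g' g hg' ⟨v, hv', hv⟩
  have hconn : ∀ v w, Relation.EqvGen (fun a b => ∃ e, G.src e = a ∧ G.tgt e = b) v w →
      (S v ↔ S w) := by
    intro v w h
    induction h with
    | rel v w h =>
      obtain ⟨g, rfl, rfl⟩ := h
      exact ⟨fun h => ⟨g, hRS g _ (Or.inl rfl) h, Or.inr rfl⟩,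
        fun h => ⟨g, hRS g _ (Or.inr rfl) h, Or.inl rfl⟩⟩
    | refl => exact Iff.rfl
    | symm _ _ _ ih => exact ih.symm
    | trans _ _ _ _ _ ih1 ih2 => exact ih1.trans ih2
  obtain ⟨a, l, hl, he⟩ := hG.exists_isClosedTrail e
  exact hRS f _ (Or.inl rfl) ((hconn _ _ (G.connected (G.src e) _)).1
    ⟨e, ⟨a, l, hl, he, he⟩, Or.inl rfl⟩)

end MetricGraph

/-! ### Discrete Poincaré inequality for samples along the edges. -/

namespace MetricGraph

variable {V E : Type*} {G : MetricGraph V E}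

/-- The list of samples `S d.1`, read in the direction of the dart `d`. -/
def dartList (S : E → List ℝ) (d : E × Bool) : List ℝ := if d.2 then S d.1 else (S d.1).reverse

theorem sqVar_dartList (S : E → List ℝ) (d : E × Bool) : (dartList S d).sqVar = (S d.1).sqVar := by
  unfold dartList; split_ifs
  · rfl
  · exact List.sqVar_reverse _

theorem dartList_perm (S : E → List ℝ) (d : E × Bool) : (dartList S d).Perm (S d.1) := by
  unfold dartList; split_ifs
  · rfl
  · exact List.reverse_perm _

theorem head?_dartList {S : E → List ℝ} {c : V → ℝ}
    (hsrc : ∀ e, (S e).head? = some (c (G.src e)))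
    (htgt : ∀ e, (S e).getLast? = some (c (G.tgt e)))
    (d : E × Bool) : (dartList S d).head? = some (c (G.tail d)) := by
  rcases d with ⟨e, _ | _⟩ <;> simp [dartList, tail, hsrc, htgt]

theorem getLast?_dartList {S : E → List ℝ} {c : V → ℝ}
    (hsrc : ∀ e, (S e).head? = some (c (G.src e)))
    (htgt : ∀ e, (S e).getLast? = some (c (G.tgt e)))
    (d : E × Bool) : (dartList S d).getLast? = some (c (G.head d)) := by
  rcases d with ⟨e, _ | _⟩ <;> simp [dartList, head, hsrc, htgt]

/-- Consecutive edges repeat the value at their common vertex, so the junctions contribute zero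
increments. The claim on the head is what carries the induction. -/
theorem IsWalk.sqVar_flatMap {S : E → List ℝ} {c : V → ℝ}
    (hsrc : ∀ e, (S e).head? = some (c (G.src e)))
    (htgt : ∀ e, (S e).getLast? = some (c (G.tgt e))) :
    ∀ {l : List (E × Bool)} {a b : V}, G.IsWalk a l b →
    (l.flatMap (dartList S) ++ [c b]).head? = some (c a) ∧
    (l.flatMap (dartList S) ++ [c b]).sqVar = (l.map fun d => (S d.1).sqVar).sum
  | [], a, b, h => by
    obtain rfl : a = b := h
    simp [List.sqVar]
  | d :: l, a, b, h => by
    obtain ⟨h1, h2⟩ := IsWalk.sqVar_flatMap hsrc htgt h.2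
    obtain ⟨m, hm⟩ : ∃ m, l.flatMap (dartList S) ++ [c b] = c (G.head d) :: m := by
      obtain ⟨m, hm⟩ := List.head?_eq_some_iff.1 h1
      exact ⟨m, hm⟩
    rw [List.flatMap_cons, List.append_assoc, List.map_cons, List.sum_cons, ← h2,
      ← sqVar_dartList S d, hm]
    refine ⟨?_, List.sqVar_append_cons _ _ _ (getLast?_dartList hsrc htgt d)⟩
    rw [List.head?_append, head?_dartList hsrc htgt, h.1]
    rfl

/-- Discrete Poincaré inequality on a graph covered by cycles, for functions sampled along the
edges. -/
theorem HasCycleCovering.discrete_poincare [Fintype E] [Nonempty E] (hG : G.HasCycleCovering)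
    {S : E → List ℝ} {c : V → ℝ} (hsrc : ∀ e, (S e).head? = some (c (G.src e)))
    (htgt : ∀ e, (S e).getLast? = some (c (G.tgt e))) :
    4 * Real.sin (Real.pi / (∑ e, (S e).length : ℕ)) ^ 2 *
      (∑ e, ((S e).map (· ^ 2)).sum - (∑ e, (S e).sum) ^ 2 / (∑ e, (S e).length : ℕ))
      ≤ ∑ e, (S e).sqVar := by
  classical
  have hne : ∀ e, S e ≠ [] := fun e h => by simpa [h] using hsrc e
  obtain ⟨e₀⟩ := ‹Nonempty E›
  set all : Finset ℝ := Finset.univ.biUnion fun e => (S e).toFinset with hall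
  have hmem : ∀ x, x ∈ all ↔ ∃ e, x ∈ S e := fun x => by simp [hall]
  have hall_ne : all.Nonempty := by
    obtain ⟨x, hx⟩ := List.exists_mem_of_ne_nil _ (hne e₀)
    exact ⟨x, (hmem x).2 ⟨e₀, hx⟩⟩
  obtain ⟨p, hp, hpmin⟩ := all.exists_min_image id hall_ne
  obtain ⟨q, hq, hqmax⟩ := all.exists_max_image id hall_ne
  obtain ⟨e, hpe⟩ := (hmem p).1 hp
  obtain ⟨f, hqf⟩ := (hmem q).1 hq
  -- The trail visits both extreme values, so the samples off it can all be inserted.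
  obtain ⟨a, T, ⟨hT, hTn⟩, heT, hfT⟩ := hG.exists_common e f
  have hTS : ∀ e x, e ∈ T.map Prod.fst → x ∈ S e → x ∈ T.flatMap (dartList S) := by
    intro e x he hx
    obtain ⟨d, hd, rfl⟩ := List.mem_map.1 he
    exact List.mem_flatMap.2 ⟨d, hd, (dartList_perm S d).mem_iff.2 hx⟩
  have hpT := hTS e p heT hpe
  have hqT := hTS f q hfT hqf
  obtain ⟨hhead, hvar⟩ := hT.sqVar_flatMap hsrc htgt
  -- Serves for the length, the sum and the sum of squares alike: additive quantities insensitive to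
  -- order.
  have hsum : ∀ {M : Type} [AddCommMonoid M] (g : List ℝ → M), (∀ l m, g (l ++ m) = g l + g m) →
      g [] = 0 → (∀ l m : List ℝ, l.Perm m → g l = g m) →
      g (T.flatMap (dartList S)) = ∑ e ∈ (T.map Prod.fst).toFinset, g (S e) := by
    intro M _ g hadd h0 hperm
    rw [List.sum_toFinset _ hTn, List.map_map]
    clear hTS hpT hqT hhead hvar heT hfT hT hTn
    induction T with
    | nil => simpa using h0
    | cons d T ih =>
      rw [List.flatMap_cons, hadd, ih, List.map_cons, List.sum_cons, hperm _ _ (dartList_perm S d)]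
      rfl
  set R : Finset E := Finset.univ \ (T.map Prod.fst).toFinset with hR
  have hsumR : ∀ {M : Type} [AddCommMonoid M] (g : List ℝ → M), (∀ l m, g (l ++ m) = g l + g m) →
      g [] = 0 → g (R.toList.flatMap S) = ∑ e ∈ R, g (S e) := by
    intro M _ g hadd h0
    rw [← Finset.sum_map_toList]
    induction R.toList with
    | nil => simpa using h0
    | cons d l ih => rw [List.flatMap_cons, hadd, ih, List.map_cons, List.sum_cons]
  obtain ⟨x, l, hxl⟩ : ∃ x l, T.flatMap (dartList S) = x :: l :=
    List.exists_cons_of_ne_nil (List.ne_nil_of_mem hpT)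
  have hxa : x = c a := by simpa [hxl] using hhead
  rw [← hxa, hxl] at hvar
  obtain ⟨l', hl', hvar'⟩ := List.exists_insert_list_sqVar_le x p q (R.toList.flatMap S) l
    (hxl ▸ hpT) (hxl ▸ hqT) (by
      intro t ht
      obtain ⟨e, -, he⟩ := List.mem_flatMap.1 ht
      have := (hmem t).2 ⟨e, he⟩
      exact ⟨hpmin t this, hqmax t this⟩)
  have hW := List.wirtinger x l'
  have htot : ∀ {M : Type} [AddCommMonoid M] (g : List ℝ → M), (∀ l m, g (l ++ m) = g l + g m) →
      g [] = 0 → (∀ l m : List ℝ, l.Perm m → g l = g m) → g (x :: l') = ∑ e, g (S e) := by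
    intro M _ g hadd h0 hperm
    rw [hperm (x :: l') (R.toList.flatMap S ++ x :: l)
      ((hl'.cons x).trans List.perm_middle.symm), hadd, ← hxl, hsum g hadd h0 hperm,
      hsumR g hadd h0, hR]
    exact Finset.sum_sdiff (Finset.subset_univ _)
  have t1 := htot List.length (fun _ _ => List.length_append) rfl fun _ _ h => h.length_eq
  have t2 := htot List.sum (fun _ _ => List.sum_append) rfl fun _ _ h => h.sum_eq
  have t3 := htot (fun l => (l.map (· ^ 2)).sum) (fun _ _ => by simp) rfl
    fun _ _ h => (h.map _).sum_eq
  rw [t1, t2, t3] at hW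
  refine hW.trans (hvar'.trans ?_)
  rw [hvar]
  have : (T.map fun d => (S d.1).sqVar).sum = ∑ e ∈ (T.map Prod.fst).toFinset, (S e).sqVar := by
    rw [List.sum_toFinset _ hTn, List.map_map]; rfl
  rw [this]
  exact Finset.sum_le_sum_of_subset_of_nonneg (Finset.subset_univ _) fun e _ _ =>
    List.sqVar_nonneg _

/-- The graph obtained by replacing each edge by two parallel edges. -/
def double (G : MetricGraph V E) : MetricGraph V (E × Bool) where
  src e := G.src e.1
  tgt e := G.tgt e.1
  len e := G.len e.1
  len_pos e := G.len_pos e.1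
  connected v w := (G.connected v w).mono fun _ _ ⟨e, h⟩ => ⟨(e, true), h⟩

/-- Going along one copy of an edge and back along the other is a cycle. -/
theorem hasCycleCovering_double (G : MetricGraph V E) : G.double.HasCycleCovering := by
  rintro ⟨e, b⟩
  refine ⟨1, ![((e, true), true), ((e, false), false)], ⟨?_, ?_⟩, ?_⟩
  · intro i j h
    fin_cases i <;> fin_cases j <;> simp_all
  · intro i
    fin_cases i <;> simp [head, tail, double]
  · rcases b with _ | _
    · exact ⟨1, rfl⟩
    · exact ⟨0, rfl⟩

end MetricGraph

/-! ### Estimates on one edge: Cauchy–Schwarz, samples and Riemann sums. -/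

open MeasureTheory Filter Topology Set

/-- Cauchy–Schwarz against 1, from the nonnegativity of the variance of g. -/
theorem sq_integral_le {g : ℝ → ℝ} {x y : ℝ} (hxy : x ≤ y) (hg : IntervalIntegrable g volume x y)
    (hg2 : IntervalIntegrable (fun t => g t ^ 2) volume x y) :
    (∫ t in x..y, g t) ^ 2 ≤ (y - x) * ∫ t in x..y, g t ^ 2 := by
  rcases hxy.eq_or_lt with rfl | hxy'
  · simp
  have hpos : 0 < y - x := sub_pos.2 hxy'
  set m := (∫ t in x..y, g t) / (y - x) with hm
  have h : 0 ≤ ∫ t in x..y, (g t - m) ^ 2 :=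
    intervalIntegral.integral_nonneg hxy fun t _ => sq_nonneg _
  have e : ∫ t in x..y, (g t - m) ^ 2
      = (∫ t in x..y, g t ^ 2) - 2 * m * (∫ t in x..y, g t) + m ^ 2 * (y - x) := by
    have : ∀ t, (g t - m) ^ 2 = g t ^ 2 - 2 * m * g t + m ^ 2 := fun t => by ring
    simp_rw [this]
    rw [intervalIntegral.integral_add (hg2.sub (hg.const_mul _)) (by simp),
      intervalIntegral.integral_sub hg2 (hg.const_mul _), intervalIntegral.integral_const_mul,
      intervalIntegral.integral_const, smul_eq_mul]
    ring
  have hm' : m * (y - x) = ∫ t in x..y, g t := by rw [hm]; field_simp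
  rw [e] at h
  rw [← hm'] at h ⊢
  nlinarith

/-- `f` is absolutely continuous on `[0, ℓ]` with square integrable derivative. -/
def MemH1Interval (f : ℝ → ℝ) (ℓ : ℝ) : Prop :=
  AbsolutelyContinuousOnInterval f 0 ℓ ∧ MemLp (deriv f) 2 (volume.restrict (Ioc 0 ℓ))

namespace MemH1Interval

variable {f : ℝ → ℝ} {ℓ : ℝ}

theorem continuousOn (hf : MemH1Interval f ℓ) (hℓ : 0 ≤ ℓ) : ContinuousOn f (Icc 0 ℓ) := by
  simpa [uIcc_of_le hℓ] using hf.1.continuousOn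

theorem intervalIntegrable_sq (hf : MemH1Interval f ℓ) (hℓ : 0 ≤ ℓ) :
    IntervalIntegrable (fun t => deriv f t ^ 2) volume 0 ℓ := by
  rw [intervalIntegrable_iff_integrableOn_Ioc_of_le hℓ]
  exact hf.2.integrable_sq

theorem sq_sub_le (hf : MemH1Interval f ℓ) {x y : ℝ} (hx : 0 ≤ x) (hxy : x ≤ y) (hy : y ≤ ℓ) :
    (f x - f y) ^ 2 ≤ (y - x) * ∫ t in x..y, deriv f t ^ 2 := by
  have hsub : uIcc x y ⊆ uIcc 0 ℓ := by
    rw [uIcc_of_le hxy, uIcc_of_le (hx.trans (hxy.trans hy))]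
    exact Icc_subset_Icc hx hy
  have hac := hf.1.mono hsub
  rw [← neg_sub, neg_sq, ← hac.integral_deriv_eq_sub]
  exact sq_integral_le hxy hac.intervalIntegrable_deriv
    ((hf.intervalIntegrable_sq (hx.trans (hxy.trans hy))).mono_set hsub)

end MemH1Interval

/-- The values of `f` at the `n + 1` points `j ℓ / n`. -/
noncomputable def sampleList (f : ℝ → ℝ) (ℓ : ℝ) (n : ℕ) : List ℝ :=
  (List.range (n + 1)).map fun j : ℕ => f (j * ℓ / n)

theorem List.sqVar_map_range (s : ℕ → ℝ) (n : ℕ) :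
    ((List.range (n + 1)).map s).sqVar = ∑ j ∈ Finset.range n, (s j - s (j + 1)) ^ 2 := by
  induction n with
  | zero => simp [List.sqVar]
  | succ n ih =>
    rw [Finset.sum_range_succ, ← ih]
    rw [List.range_succ, List.range_succ, List.map_append, List.map_append]
    exact List.sqVar_concat_concat _ _ _

/-- Cauchy–Schwarz on each of the n subintervals of length ℓ/n. -/
theorem MemH1Interval.sqVar_sampleList_le {f : ℝ → ℝ} {ℓ : ℝ} (hf : MemH1Interval f ℓ)
    (hℓ : 0 < ℓ) {n : ℕ} (hn : 0 < n) :
    (sampleList f ℓ n).sqVar ≤ ℓ / n * ∫ t in (0 : ℝ)..ℓ, deriv f t ^ 2 := by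
  have hn' : (0 : ℝ) < n := by exact_mod_cast hn
  have hmono : ∀ j : ℕ, (j : ℝ) * ℓ / n ≤ ((j + 1 : ℕ) : ℝ) * ℓ / n := fun j => by
    gcongr; exact_mod_cast Nat.le_succ j
  have hle : ∀ j ≤ n, (j : ℝ) * ℓ / n ≤ ℓ := fun j hj => by
    rw [div_le_iff₀ hn', mul_comm]; gcongr
  have h0 : ∀ j : ℕ, 0 ≤ (j : ℝ) * ℓ / n := fun j => by positivity
  unfold sampleList
  rw [List.sqVar_map_range]
  calc _ ≤ ∑ j ∈ Finset.range n,
        ℓ / n * ∫ t in ((j : ℝ) * ℓ / n)..(((j + 1 : ℕ) : ℝ) * ℓ / n), deriv f t ^ 2 := by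
        refine Finset.sum_le_sum fun j hj => ?_
        rw [Finset.mem_range] at hj
        refine (hf.sq_sub_le (h0 j) (hmono j) (hle _ hj)).trans (le_of_eq ?_)
        congr 1
        push_cast; field_simp; ring
    _ = _ := by
        rw [← Finset.mul_sum, intervalIntegral.sum_integral_adjacent_intervals
          (a := fun j : ℕ => (j : ℝ) * ℓ / n)]
        · simp only [CharP.cast_eq_zero, zero_mul, zero_div]
          rw [mul_div_cancel_left₀ _ hn'.ne']
        · intro j hj
          refine (hf.intervalIntegrable_sq hℓ.le).mono_set ?_
          rw [uIcc_of_le (hmono j), uIcc_of_le hℓ.le]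
          exact Icc_subset_Icc (h0 j) (hle _ hj)

theorem tendsto_riemann_sum {g : ℝ → ℝ} {ℓ : ℝ} (hℓ : 0 < ℓ) (hg : ContinuousOn g (Icc 0 ℓ)) :
    Tendsto (fun n : ℕ => ℓ / n * ∑ j ∈ Finset.range n, g (j * ℓ / n)) atTop
      (𝓝 (∫ t in (0 : ℝ)..ℓ, g t)) := by
  have huc := isCompact_Icc.uniformContinuousOn_of_continuous hg
  rw [Metric.uniformContinuousOn_iff] at huc
  rw [Metric.tendsto_atTop]
  intro ε hε
  obtain ⟨δ, hδ, h⟩ := huc (ε / (2 * ℓ)) (by positivity)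
  obtain ⟨n₀, hn₀⟩ := exists_nat_gt (ℓ / δ)
  refine ⟨n₀ + 1, fun n hn => ?_⟩
  have hn' : (0 : ℝ) < n := by exact_mod_cast (by omega : 0 < n)
  have hnδ : ℓ / n < δ := by
    rw [div_lt_iff₀ hn', ← div_lt_iff₀' hδ]
    refine hn₀.trans_le ?_
    exact_mod_cast (by omega : n₀ ≤ n)
  have hstep : ∀ j : ℕ, ((j + 1 : ℕ) : ℝ) * ℓ / n - (j : ℝ) * ℓ / n = ℓ / n := fun j => by
    push_cast; field_simp; ring
  have hmono : ∀ j : ℕ, (j : ℝ) * ℓ / n ≤ ((j + 1 : ℕ) : ℝ) * ℓ / n := fun j => by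
    gcongr; exact_mod_cast Nat.le_succ j
  have hle : ∀ j ≤ n, (j : ℝ) * ℓ / n ≤ ℓ := fun j hj => by
    rw [div_le_iff₀ hn', mul_comm]; gcongr
  have h0 : ∀ j : ℕ, 0 ≤ (j : ℝ) * ℓ / n := fun j => by positivity
  have hsub : ∀ j < n, Icc ((j : ℝ) * ℓ / n) (((j + 1 : ℕ) : ℝ) * ℓ / n) ⊆ Icc 0 ℓ := fun j hj =>
    Icc_subset_Icc (h0 j) (hle _ hj)
  have hint : ∀ j < n, IntervalIntegrable g volume ((j : ℝ) * ℓ / n)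
      (((j + 1 : ℕ) : ℝ) * ℓ / n) := fun j hj => by
    refine ContinuousOn.intervalIntegrable ?_
    rw [uIcc_of_le (hmono j)]
    exact hg.mono (hsub j hj)
  have e1 : ∫ t in (0 : ℝ)..ℓ, g t = ∑ j ∈ Finset.range n,
      ∫ t in ((j : ℝ) * ℓ / n)..(((j + 1 : ℕ) : ℝ) * ℓ / n), g t := by
    rw [intervalIntegral.sum_integral_adjacent_intervals (a := fun j : ℕ => (j : ℝ) * ℓ / n) hint]
    simp only [CharP.cast_eq_zero, zero_mul, zero_div]
    rw [mul_div_cancel_left₀ _ hn'.ne']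
  rw [e1, Finset.mul_sum, dist_eq_norm, ← Finset.sum_sub_distrib]
  calc _ ≤ ∑ j ∈ Finset.range n, ε / (2 * ℓ) * (ℓ / n) := by
        refine (norm_sum_le _ _).trans (Finset.sum_le_sum fun j hj => ?_)
        rw [Finset.mem_range] at hj
        have e2 : ℓ / n * g (j * ℓ / n)
            = ∫ t in ((j : ℝ) * ℓ / n)..(((j + 1 : ℕ) : ℝ) * ℓ / n), g (j * ℓ / n) := by
          rw [intervalIntegral.integral_const, hstep, smul_eq_mul]
        rw [e2, ← intervalIntegral.integral_sub (by simp) (hint j hj)]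
        refine (intervalIntegral.norm_integral_le_of_norm_le_const (C := ε / (2 * ℓ)) ?_).trans ?_
        · intro t ht
          rw [uIoc_of_le (hmono j)] at ht
          rw [← dist_eq_norm]
          refine (h _ (hsub j hj (left_mem_Icc.2 (hmono j))) _ (hsub j hj ⟨ht.1.le, ht.2⟩) ?_).le
          rw [dist_comm, Real.dist_eq, abs_of_pos (by linarith [ht.1])]
          have := hstep j
          linarith [ht.2]
        · rw [hstep, abs_of_pos (by positivity)]
    _ = ε / 2 := by
        rw [Finset.sum_const, Finset.card_range, nsmul_eq_mul]; field_simp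
    _ < ε := by linarith

theorem tendsto_ceil_div {ℓ : ℝ} (hℓ : 0 < ℓ) :
    Tendsto (fun k : ℕ => (⌈ℓ * k⌉₊ : ℝ) / k) atTop (𝓝 ℓ) :=
  (tendsto_nat_ceil_mul_div_atTop hℓ.le).comp tendsto_natCast_atTop_atTop

theorem tendsto_sum_sampleList {g : ℝ → ℝ} {ℓ : ℝ} (hℓ : 0 < ℓ) (hg : ContinuousOn g (Icc 0 ℓ)) :
    Tendsto (fun k : ℕ => (sampleList g ℓ ⌈ℓ * k⌉₊).sum / k) atTop
      (𝓝 (∫ t in (0 : ℝ)..ℓ, g t)) := by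
  have hceil : Tendsto (fun k : ℕ => ⌈ℓ * k⌉₊) atTop atTop :=
    tendsto_nat_ceil_atTop.comp (tendsto_natCast_atTop_atTop.const_mul_atTop hℓ)
  have h1 := (tendsto_riemann_sum hℓ hg).comp hceil
  have h2 := ((tendsto_ceil_div hℓ).div_const ℓ).mul h1
  have h3 : Tendsto (fun k : ℕ => g ℓ / (k : ℝ)) atTop (𝓝 0) :=
    tendsto_const_div_atTop_nhds_zero_nat _
  have h4 := h2.add h3
  rw [div_self hℓ.ne', one_mul, add_zero] at h4
  -- A sample list has one more point than the Riemann sum; its weight 1/k vanishes in the limit.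
  refine h4.congr' ?_
  filter_upwards [eventually_gt_atTop 0] with k hk
  have hk' : (0 : ℝ) < k := by exact_mod_cast hk
  have hn : (0 : ℝ) < ⌈ℓ * k⌉₊ := by exact_mod_cast Nat.ceil_pos.2 (by positivity)
  simp only [Function.comp_apply, sampleList]
  rw [List.range_succ, List.map_append, List.sum_append, List.map_singleton, List.sum_singleton,
    mul_div_cancel_left₀ _ hn.ne']
  rw [show ((List.range ⌈ℓ * k⌉₊).map fun j : ℕ => g (j * ℓ / ⌈ℓ * k⌉₊)).sum
    = ∑ j ∈ Finset.range ⌈ℓ * k⌉₊, g (j * ℓ / ⌈ℓ * k⌉₊) from rfl]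
  field_simp

/-! ### Passage to the limit: lower bounds for real functions of zero mean. -/

namespace MetricGraph

variable {V E : Type*} {G : MetricGraph V E}

/-- A real function on the graph belongs to `H¹`. -/
def MemH1Real (G : MetricGraph V E) (u : E → ℝ → ℝ) : Prop :=
  (∀ e, MemH1Interval (u e) (G.len e)) ∧
  ∃ c : V → ℝ, ∀ e, u e 0 = c (G.src e) ∧ u e (G.len e) = c (G.tgt e)

variable [Fintype E]

theorem length_pos [Nonempty E] (G : MetricGraph V E) : 0 < G.length :=
  Finset.sum_pos (fun e _ => G.len_pos e) Finset.univ_nonempty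

theorem sum_eq_sum_map_sampleList (u : ℝ → ℝ) (ℓ : ℝ) (n : ℕ) :
    ((sampleList u ℓ n).map (· ^ 2)).sum = (sampleList (fun x => u x ^ 2) ℓ n).sum := by
  simp [sampleList, Function.comp_def]

/-- On a graph covered by cycles, `λ₂ ≥ (2π / |G|)²`. -/
theorem HasCycleCovering.poincare [Nonempty E] (hG : G.HasCycleCovering) {u : E → ℝ → ℝ}
    (hu : G.MemH1Real u) (h0 : G.integral u = 0) :
    (2 * Real.pi / G.length) ^ 2 * (G.integral fun e x => u e x ^ 2)
      ≤ G.integral fun e x => deriv (u e) x ^ 2 := by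
  obtain ⟨hH, c, hc⟩ := hu
  have hL := G.length_pos
  -- With ⌈ℓ k⌉ subintervals the mesh is at most 1/k on every edge, and the sampling density tends
  -- to k on all edges alike.
  set S : ℕ → E → List ℝ := fun k e => sampleList (u e) (G.len e) ⌈G.len e * k⌉₊ with hS
  set N : ℕ → ℕ := fun k => ∑ e, (S k e).length with hN
  have hcont : ∀ e, ContinuousOn (u e) (Icc 0 (G.len e)) := fun e =>
    (hH e).continuousOn (G.len_pos e).le
  have hn : ∀ k : ℕ, 0 < k → ∀ e, 0 < ⌈G.len e * k⌉₊ := fun k hk e =>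
    Nat.ceil_pos.2 (mul_pos (G.len_pos e) (by exact_mod_cast hk))
  -- The discrete inequality multiplied by k, arranged so that every factor converges.
  have main : ∀ k : ℕ, 0 < k →
      4 * (k * Real.sin (Real.pi / N k)) ^ 2 * ((∑ e, ((S k e).map (· ^ 2)).sum) / k
        - ((∑ e, (S k e).sum) / k) ^ 2 / (N k / k))
      ≤ G.integral fun e x => deriv (u e) x ^ 2 := by
    intro k hk
    have hk' : (0 : ℝ) < k := by exact_mod_cast hk
    have hd := hG.discrete_poincare (S := S k) (c := c) (fun e => by
        simp [hS, sampleList, List.range_succ_eq_map, (hc e).1]) (fun e => by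
        have : (⌈G.len e * k⌉₊ : ℝ) ≠ 0 := by exact_mod_cast (hn k hk e).ne'
        simp only [hS, sampleList, List.range_succ, List.map_append, List.map_singleton,
          List.getLast?_concat]
        rw [mul_div_cancel_left₀ _ this, (hc e).2])
    have hv : ∑ e, (S k e).sqVar ≤ (1 / k) * G.integral fun e x => deriv (u e) x ^ 2 := by
      rw [integral, Finset.mul_sum]
      refine Finset.sum_le_sum fun e _ =>
        ((hH e).sqVar_sampleList_le (G.len_pos e) (hn k hk e)).trans ?_
      refine mul_le_mul_of_nonneg_right ?_
        (intervalIntegral.integral_nonneg (G.len_pos e).le fun _ _ => sq_nonneg _)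
      rw [div_le_div_iff₀ (by exact_mod_cast hn k hk e) hk', one_mul]
      exact Nat.le_ceil _
    have h := mul_le_mul_of_nonneg_left (hd.trans hv) hk'.le
    rw [← mul_assoc (k : ℝ) (1 / k), mul_one_div_cancel hk'.ne', one_mul] at h
    refine le_trans (le_of_eq ?_) h
    have hNk : (N k : ℝ) ≠ 0 := by
      have : 0 < N k := Finset.sum_pos (fun e _ => by simp [hS, sampleList]) Finset.univ_nonempty
      exact_mod_cast this.ne'
    change _ = k * (4 * Real.sin (Real.pi / (N k : ℕ)) ^ 2 *
      (∑ e, ((S k e).map (· ^ 2)).sum - (∑ e, (S k e).sum) ^ 2 / (N k : ℕ)))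
    field_simp
  have t1 : Tendsto (fun k : ℕ => (∑ e, (((S k e).map (· ^ 2)).sum : ℝ)) / k) atTop
      (𝓝 (G.integral fun e x => u e x ^ 2)) := by
    simp only [hS, sum_eq_sum_map_sampleList, Finset.sum_div]
    exact tendsto_finsetSum _ fun e _ =>
      tendsto_sum_sampleList (G.len_pos e) ((hcont e).pow 2)
  have t2 : Tendsto (fun k : ℕ => (∑ e, (S k e).sum) / k) atTop (𝓝 0) := by
    rw [← h0]
    simp only [hS, Finset.sum_div]
    exact tendsto_finsetSum _ fun e _ => tendsto_sum_sampleList (G.len_pos e) (hcont e)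
  have t3 : Tendsto (fun k : ℕ => (N k : ℝ) / k) atTop (𝓝 G.length) := by
    have : ∀ k : ℕ, (N k : ℝ) / k = ∑ e, (((⌈G.len e * k⌉₊ : ℝ) / k) + 1 / k) := fun k => by
      simp [hN, hS, sampleList, Finset.sum_div, add_div]
    simp only [this]
    refine tendsto_finsetSum _ fun e _ => ?_
    simpa using (tendsto_ceil_div (G.len_pos e)).add tendsto_one_div_atTop_nhds_zero_nat
  have tN : Tendsto (fun k : ℕ => (N k : ℝ)) atTop atTop := by
    have := t3.pos_mul_atTop hL tendsto_natCast_atTop_atTop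
    refine this.congr' ?_
    filter_upwards [eventually_gt_atTop 0] with k hk
    have hk' : (k : ℝ) ≠ 0 := by exact_mod_cast hk.ne'
    field_simp
  have t4 : Tendsto (fun k : ℕ => k * Real.sin (Real.pi / N k)) atTop
      (𝓝 (Real.pi / G.length)) := by
    have s1 : Tendsto (fun k : ℕ => Real.pi / (N k : ℝ)) atTop (𝓝 0) := tN.const_div_atTop _
    have s2 : Tendsto (fun k : ℕ => Real.sinc (Real.pi / N k)) atTop (𝓝 1) := by
      have := (Real.continuous_sinc.tendsto 0).comp s1
      rwa [Real.sinc_zero] at this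
    have s3 := (s2.mul ((tendsto_const_nhds (x := Real.pi)).div t3 hL.ne'))
    rw [one_mul] at s3
    refine s3.congr' ?_
    filter_upwards [eventually_gt_atTop 0, tN.eventually_gt_atTop 0] with k hk hNk
    have hk' : (k : ℝ) ≠ 0 := by exact_mod_cast hk.ne'
    have hp := Real.pi_pos.ne'
    rw [Real.sinc_of_ne_zero (by positivity), Pi.div_apply]
    field_simp
  have t5 := ((t4.pow 2).const_mul 4).mul (t1.sub ((t2.pow 2).div t3 hL.ne'))
  have e : 4 * (Real.pi / G.length) ^ 2 *
      ((G.integral fun e x => u e x ^ 2) - 0 ^ 2 / G.length)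
      = (2 * Real.pi / G.length) ^ 2 * (G.integral fun e x => u e x ^ 2) := by ring
  rw [e] at t5
  refine le_of_tendsto t5 ?_
  filter_upwards [eventually_gt_atTop 0] with k hk
  exact main k hk

/-- On every graph, `λ₂ ≥ (π / |G|)²`. -/
theorem poincare [Nonempty E] {u : E → ℝ → ℝ}
    (hu : G.MemH1Real u) (h0 : G.integral u = 0) :
    (Real.pi / G.length) ^ 2 * (G.integral fun e x => u e x ^ 2)
      ≤ G.integral fun e x => deriv (u e) x ^ 2 := by
  have hint : ∀ w : E → ℝ → ℝ, (G.double.integral fun e x => w e.1 x) = 2 * G.integral w := by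
    intro w
    simp only [integral, double, Fintype.sum_prod_type, Fintype.sum_bool, Finset.mul_sum, two_mul]
  have hlen : G.double.length = 2 * G.length := by
    simp only [length, double, Fintype.sum_prod_type, Fintype.sum_bool, Finset.mul_sum, two_mul]
  -- Lift u to both copies of each edge: the integrals double, and 2π/(2|G|) = π/|G|.
  have h := G.hasCycleCovering_double.poincare (u := fun e => u e.1)
    ⟨fun e => hu.1 e.1, hu.2.choose, fun e => hu.2.choose_spec e.1⟩ (by rw [hint u, h0, mul_zero])
  rw [hint fun e x => u e x ^ 2, hint fun e x => deriv (u e) x ^ 2, hlen,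
    mul_div_mul_left _ _ two_ne_zero] at h
  linarith

end MetricGraph

/-! ### Reduction of complex functions to real and imaginary parts. -/

theorem LipschitzWith.comp_absolutelyContinuousOnInterval {X Y : Type*} [PseudoMetricSpace X]
    [PseudoMetricSpace Y] {g : X → Y} (hg : LipschitzWith 1 g) {f : ℝ → X} {a b : ℝ}
    (hf : AbsolutelyContinuousOnInterval f a b) :
    AbsolutelyContinuousOnInterval (fun x => g (f x)) a b := by
  refine squeeze_zero (fun t => Finset.sum_nonneg fun _ _ => dist_nonneg) (fun t => ?_) hf
  exact Finset.sum_le_sum fun i _ => by simpa using hg.dist_le_mul _ _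

theorem Complex.lipschitzWith_re : LipschitzWith 1 Complex.re :=
  LipschitzWith.of_dist_le_mul fun x y => by
    simpa [Real.dist_eq, Complex.dist_eq] using Complex.abs_re_le_norm (x - y)

theorem Complex.lipschitzWith_im : LipschitzWith 1 Complex.im :=
  LipschitzWith.of_dist_le_mul fun x y => by
    simpa [Real.dist_eq, Complex.dist_eq] using Complex.abs_im_le_norm (x - y)

section Edge

variable {f : ℝ → ℂ} {ℓ : ℝ}

theorem ae_hasDerivAt_of_absolutelyContinuous (hℓ : 0 ≤ ℓ)
    (hf : AbsolutelyContinuousOnInterval f 0 ℓ) :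
    ∀ᵐ x ∂volume.restrict (Ioc 0 ℓ), HasDerivAt f (deriv f x) x := by
  have h1 := (Complex.lipschitzWith_re.comp_absolutelyContinuousOnInterval hf).ae_differentiableAt
  have h2 := (Complex.lipschitzWith_im.comp_absolutelyContinuousOnInterval hf).ae_differentiableAt
  rw [ae_restrict_iff' measurableSet_Ioc]
  filter_upwards [h1, h2] with x h1 h2 hx
  have hx' : x ∈ uIcc 0 ℓ := by rw [uIcc_of_le hℓ]; exact ⟨hx.1.le, hx.2⟩
  have h := ((h1 hx').hasDerivAt.ofReal_comp).add
    (((h2 hx').hasDerivAt.ofReal_comp).mul_const Complex.I)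
  have e : f = (fun y => ((f y).re : ℂ)) + fun y => ((f y).im : ℂ) * Complex.I := by
    ext y; simp [Complex.re_add_im]
  rw [← e] at h
  exact h.differentiableAt.hasDerivAt

theorem ae_deriv_re (hℓ : 0 ≤ ℓ) (hf : AbsolutelyContinuousOnInterval f 0 ℓ) :
    (fun x => (deriv f x).re) =ᵐ[volume.restrict (Ioc 0 ℓ)] deriv fun x => (f x).re := by
  filter_upwards [ae_hasDerivAt_of_absolutelyContinuous hℓ hf] with x hx
  exact ((Complex.reCLM.hasFDerivAt.comp_hasDerivAt x hx).deriv).symm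

theorem ae_deriv_im (hℓ : 0 ≤ ℓ) (hf : AbsolutelyContinuousOnInterval f 0 ℓ) :
    (fun x => (deriv f x).im) =ᵐ[volume.restrict (Ioc 0 ℓ)] deriv fun x => (f x).im := by
  filter_upwards [ae_hasDerivAt_of_absolutelyContinuous hℓ hf] with x hx
  exact ((Complex.imCLM.hasFDerivAt.comp_hasDerivAt x hx).deriv).symm

theorem memH1Interval_re (hℓ : 0 ≤ ℓ) (hf : AbsolutelyContinuousOnInterval f 0 ℓ)
    (hf2 : MemLp (deriv f) 2 (volume.restrict (Ioc 0 ℓ))) :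
    MemH1Interval (fun x => (f x).re) ℓ :=
  ⟨Complex.lipschitzWith_re.comp_absolutelyContinuousOnInterval hf,
    hf2.re.ae_eq (ae_deriv_re hℓ hf)⟩

theorem memH1Interval_im (hℓ : 0 ≤ ℓ) (hf : AbsolutelyContinuousOnInterval f 0 ℓ)
    (hf2 : MemLp (deriv f) 2 (volume.restrict (Ioc 0 ℓ))) :
    MemH1Interval (fun x => (f x).im) ℓ :=
  ⟨Complex.lipschitzWith_im.comp_absolutelyContinuousOnInterval hf,
    hf2.im.ae_eq (ae_deriv_im hℓ hf)⟩

theorem integral_norm_deriv_sq {a b : ℝ} (ha : 0 ≤ a) (hab : a ≤ b) (hb : b ≤ ℓ)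
    (hf : AbsolutelyContinuousOnInterval f 0 ℓ)
    (hf2 : MemLp (deriv f) 2 (volume.restrict (Ioc 0 ℓ))) :
    ∫ x in a..b, ‖deriv f x‖ ^ 2 = (∫ x in a..b, deriv (fun x => (f x).re) x ^ 2)
      + ∫ x in a..b, deriv (fun x => (f x).im) x ^ 2 := by
  have hℓ := ha.trans (hab.trans hb)
  have hsub : uIcc a b ⊆ uIcc 0 ℓ := by
    rw [uIcc_of_le hab, uIcc_of_le hℓ]; exact Icc_subset_Icc ha hb
  rw [← intervalIntegral.integral_add
    (((memH1Interval_re hℓ hf hf2).intervalIntegrable_sq hℓ).mono_set hsub)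
    (((memH1Interval_im hℓ hf hf2).intervalIntegrable_sq hℓ).mono_set hsub)]
  refine intervalIntegral.integral_congr_ae ?_
  have h1 := ae_deriv_re hℓ hf
  have h2 := ae_deriv_im hℓ hf
  rw [Filter.EventuallyEq, ae_restrict_iff' measurableSet_Ioc] at h1 h2
  filter_upwards [h1, h2] with x h1 h2 hx
  rw [uIoc_of_le hab] at hx
  have hx' : x ∈ Ioc 0 ℓ := ⟨ha.trans_lt hx.1, hx.2.trans hb⟩
  rw [← h1 hx', ← h2 hx', Complex.sq_norm, Complex.normSq_apply]
  ring

end Edge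

theorem MemH1Interval.ofReal {r : ℝ → ℝ} {ℓ : ℝ} (hℓ : 0 ≤ ℓ) (hr : MemH1Interval r ℓ) :
    AbsolutelyContinuousOnInterval (fun x => (r x : ℂ)) 0 ℓ ∧
      MemLp (deriv fun x => (r x : ℂ)) 2 (volume.restrict (Ioc 0 ℓ)) := by
  have hac : AbsolutelyContinuousOnInterval (fun x => (r x : ℂ)) 0 ℓ :=
    Complex.isometry_ofReal.lipschitz.comp_absolutelyContinuousOnInterval hr.1
  refine ⟨hac, ?_⟩
  have h1 : MemLp (fun x => ((deriv r x : ℝ) : ℂ)) 2 (volume.restrict (Ioc 0 ℓ)) := hr.2.ofReal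
  refine h1.ae_eq ?_
  have h := hr.1.ae_differentiableAt
  rw [Filter.EventuallyEq, ae_restrict_iff' measurableSet_Ioc]
  filter_upwards [h] with x h hx
  have hx' : x ∈ uIcc 0 ℓ := by rw [uIcc_of_le hℓ]; exact ⟨hx.1.le, hx.2⟩
  exact ((h hx').hasDerivAt.ofReal_comp.deriv).symm

/-! ### Integration on the graph, λ₂ and the bounds on the threshold. -/

namespace MetricGraph

variable {V E : Type*} {G : MetricGraph V E}

theorem MemH1.continuousOn {u : E → ℝ → ℂ} (hu : G.MemH1 u) (e : E) :
    ContinuousOn (u e) (Icc 0 (G.len e)) := by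
  simpa [uIcc_of_le (G.len_pos e).le] using (hu.1 e).1.continuousOn

theorem MemH1Real.continuousOn {u : E → ℝ → ℝ} (hu : G.MemH1Real u) (e : E) :
    ContinuousOn (u e) (Icc 0 (G.len e)) := (hu.1 e).continuousOn (G.len_pos e).le

theorem MemH1.re {u : E → ℝ → ℂ} (hu : G.MemH1 u) : G.MemH1Real fun e x => (u e x).re := by
  obtain ⟨h, c, hc⟩ := hu
  refine ⟨fun e => memH1Interval_re (G.len_pos e).le (h e).1 (h e).2, fun v => (c v).re, fun e => ?_⟩
  simp [hc e]

theorem MemH1.im {u : E → ℝ → ℂ} (hu : G.MemH1 u) : G.MemH1Real fun e x => (u e x).im := by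
  obtain ⟨h, c, hc⟩ := hu
  refine ⟨fun e => memH1Interval_im (G.len_pos e).le (h e).1 (h e).2, fun v => (c v).im, fun e => ?_⟩
  simp [hc e]

theorem MemH1Real.ofReal {r : E → ℝ → ℝ} (hr : G.MemH1Real r) :
    G.MemH1 fun e x => (r e x : ℂ) := by
  obtain ⟨h, c, hc⟩ := hr
  refine ⟨fun e => (h e).ofReal (G.len_pos e).le, fun v => (c v : ℂ), fun e => ?_⟩
  simp [hc e]

variable [Fintype E]

section Integral

variable {F : Type*} [NormedAddCommGroup F] [NormedSpace ℝ F]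

theorem integral_add {u v : E → ℝ → F} (hu : ∀ e, ContinuousOn (u e) (Icc 0 (G.len e)))
    (hv : ∀ e, ContinuousOn (v e) (Icc 0 (G.len e))) :
    (G.integral fun e x => u e x + v e x) = G.integral u + G.integral v := by
  simp only [integral, ← Finset.sum_add_distrib]
  refine Finset.sum_congr rfl fun e _ => intervalIntegral.integral_add ?_ ?_ <;>
  refine ContinuousOn.intervalIntegrable ?_ <;> rw [uIcc_of_le (G.len_pos e).le]
  exacts [hu e, hv e]

theorem integral_const [CompleteSpace F] (c : F) : (G.integral fun _ _ => c) = G.length • c := by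
  simp [integral, length, Finset.sum_smul]

theorem integral_const_mul (c : ℝ) (u : E → ℝ → ℝ) :
    (G.integral fun e x => c * u e x) = c * G.integral u := by
  simp [integral, Finset.mul_sum]

theorem integral_nonneg {u : E → ℝ → ℝ} (hu : ∀ e x, 0 ≤ u e x) : 0 ≤ G.integral u :=
  Finset.sum_nonneg fun e _ => intervalIntegral.integral_nonneg (G.len_pos e).le fun x _ => hu e x

theorem integral_mono {u v : E → ℝ → ℝ} (hu : ∀ e, ContinuousOn (u e) (Icc 0 (G.len e)))
    (hv : ∀ e, ContinuousOn (v e) (Icc 0 (G.len e)))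
    (h : ∀ e, ∀ x ∈ Icc 0 (G.len e), u e x ≤ v e x) : G.integral u ≤ G.integral v := by
  refine Finset.sum_le_sum fun e _ => intervalIntegral.integral_mono_on (G.len_pos e).le ?_ ?_
    (h e) <;>
  refine ContinuousOn.intervalIntegrable ?_ <;> rw [uIcc_of_le (G.len_pos e).le]
  exacts [hu e, hv e]

theorem norm_integral_le {u : E → ℝ → F} {C : ℝ}
    (h : ∀ e, ∀ x ∈ Icc 0 (G.len e), ‖u e x‖ ≤ C) : ‖G.integral u‖ ≤ C * G.length := by
  rw [length, Finset.mul_sum]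
  refine norm_sum_le_of_le _ fun e _ => ?_
  have := intervalIntegral.norm_integral_le_of_norm_le_const (a := 0) (b := G.len e) (f := u e)
    (C := C) fun x hx => h e x (by
      rw [uIoc_of_le (G.len_pos e).le] at hx; exact ⟨hx.1.le, hx.2⟩)
  rwa [sub_zero, abs_of_pos (G.len_pos e)] at this

theorem integral_ofReal (r : E → ℝ → ℝ) :
    (G.integral fun e x => (r e x : ℂ)) = (G.integral r : ℝ) := by
  simp [integral, intervalIntegral.integral_ofReal]

theorem re_integral {u : E → ℝ → ℂ} (hu : ∀ e, ContinuousOn (u e) (Icc 0 (G.len e))) :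
    (G.integral fun e x => (u e x).re) = (G.integral u).re := by
  simp only [integral, Complex.re_sum]
  refine Finset.sum_congr rfl fun e _ =>
    Complex.reCLM.intervalIntegral_comp_comm (ContinuousOn.intervalIntegrable ?_)
  rw [uIcc_of_le (G.len_pos e).le]; exact hu e

theorem im_integral {u : E → ℝ → ℂ} (hu : ∀ e, ContinuousOn (u e) (Icc 0 (G.len e))) :
    (G.integral fun e x => (u e x).im) = (G.integral u).im := by
  simp only [integral, Complex.im_sum]
  refine Finset.sum_congr rfl fun e _ =>
    Complex.imCLM.intervalIntegral_comp_comm (ContinuousOn.intervalIntegrable ?_)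
  rw [uIcc_of_le (G.len_pos e).le]; exact hu e

end Integral

theorem mass_nonneg (u : E → ℝ → ℂ) : 0 ≤ G.mass u := integral_nonneg fun _ _ => sq_nonneg _

theorem dirichlet_nonneg (u : E → ℝ → ℂ) : 0 ≤ G.dirichlet u :=
  integral_nonneg fun _ _ => sq_nonneg _

theorem MemH1.mass_eq {u : E → ℝ → ℂ} (hu : G.MemH1 u) :
    G.mass u = (G.integral fun e x => (u e x).re ^ 2) + G.integral fun e x => (u e x).im ^ 2 := by
  refine Eq.trans ?_ (integral_add (fun e => (hu.re.continuousOn e).pow 2)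
    fun e => (hu.im.continuousOn e).pow 2)
  rw [mass]
  congr 1; ext e x
  rw [Complex.sq_norm, Complex.normSq_apply]; ring

theorem MemH1.dirichlet_eq {u : E → ℝ → ℂ} (hu : G.MemH1 u) :
    G.dirichlet u = (G.integral fun e => fun x => deriv (fun x => (u e x).re) x ^ 2)
      + G.integral fun e => fun x => deriv (fun x => (u e x).im) x ^ 2 := by
  simp only [dirichlet, integral, ← Finset.sum_add_distrib]
  exact Finset.sum_congr rfl fun e _ =>
    integral_norm_deriv_sq le_rfl (G.len_pos e).le le_rfl (hu.1 e).1 (hu.1 e).2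

theorem mass_ofReal (r : E → ℝ → ℝ) :
    G.mass (fun e x => (r e x : ℂ)) = G.integral fun e x => r e x ^ 2 := by
  simp [mass]

theorem MemH1Real.dirichlet_ofReal {r : E → ℝ → ℝ} (hr : G.MemH1Real r) :
    G.dirichlet (fun e x => (r e x : ℂ)) = G.integral fun e x => deriv (r e) x ^ 2 := by
  rw [hr.ofReal.dirichlet_eq]
  simp [integral]

theorem MemH1.lambda2_mul_mass_le {φ : E → ℝ → ℂ} (hφ : G.MemH1 φ) (h0 : G.integral φ = 0) :
    G.lambda2 * G.mass φ ≤ G.dirichlet φ := by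
  by_cases hm : G.mass φ = 0
  · rw [hm, mul_zero]; exact dirichlet_nonneg φ
  · rw [← le_div_iff₀ ((mass_nonneg φ).lt_of_ne' hm)]
    refine csInf_le ⟨0, ?_⟩ ⟨φ, hφ, hm, h0, rfl⟩
    rintro _ ⟨ψ, -, -, -, rfl⟩
    exact div_nonneg (dirichlet_nonneg ψ) (mass_nonneg ψ)

theorem memH1Interval_of_contDiff {f : ℝ → ℝ} (hf : ContDiff ℝ 1 f) (ℓ : ℝ) :
    MemH1Interval f ℓ := by
  refine ⟨hf.contDiffOn.absolutelyContinuousOnInterval, ?_⟩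
  have hc : Continuous (deriv f) := hf.continuous_deriv le_rfl
  obtain ⟨C, hC⟩ := (isCompact_Icc (a := 0) (b := ℓ)).exists_bound_of_continuousOn hc.continuousOn
  refine MemLp.of_bound hc.aestronglyMeasurable C ?_
  rw [ae_restrict_iff' measurableSet_Ioc]
  exact Eventually.of_forall fun x hx => hC x ⟨hx.1.le, hx.2⟩

/-- Needed because `sInf ∅ = 0` in ℝ: a bound from below on `lambda2` requires an admissible
function. One full period of sine on a single edge, extended by zero, vanishes at all vertices. -/
theorem exists_memH1Real [Nonempty E] (G : MetricGraph V E) :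
    ∃ r : E → ℝ → ℝ, G.MemH1Real r ∧ G.integral r = 0 ∧ (G.integral fun e x => r e x ^ 2) ≠ 0 := by
  classical
  obtain ⟨e₀⟩ := ‹Nonempty E›
  have hℓ := G.len_pos e₀
  set c : ℝ := 2 * Real.pi / G.len e₀ with hc
  have hc0 : c ≠ 0 := by have := Real.pi_pos; positivity
  have hcl : c * G.len e₀ = 2 * Real.pi := by rw [hc]; field_simp
  have h2 : ∀ g : ℝ → ℝ, g 0 = 0 → (G.integral fun e x => g (if e = e₀ then Real.sin (c * x) else 0))
      = ∫ x in (0 : ℝ)..G.len e₀, g (Real.sin (c * x)) := by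
    intro g hg
    rw [integral, Finset.sum_eq_single e₀]
    · simp
    · intro e _ he; simp [he, hg]
    · simp
  refine ⟨fun e x => if e = e₀ then Real.sin (c * x) else 0, ⟨fun e => ?_, 0, fun e => ?_⟩, ?_, ?_⟩
  · by_cases he : e = e₀
    · simp only [he, if_true]
      exact memH1Interval_of_contDiff (Real.contDiff_sin.comp (contDiff_const.mul contDiff_id)) _
    · simp only [he, if_false]
      exact memH1Interval_of_contDiff contDiff_const _
  · by_cases he : e = e₀
    · subst he; simp [hcl]
    · simp [he]
  · refine (h2 id rfl).trans ?_
    simp only [id]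
    rw [intervalIntegral.integral_comp_mul_left (fun x => Real.sin x) hc0, hcl]
    simp
  · refine ne_of_eq_of_ne (h2 (· ^ 2) (by simp)) ?_
    rw [intervalIntegral.integral_comp_mul_left (fun x => Real.sin x ^ 2) hc0, hcl]
    simp [hc0, Real.pi_ne_zero]

/-- Real test functions suffice, since mass, Dirichlet integral and the zero-mean condition all
split into real and imaginary parts. -/
theorem le_lambda2 [Nonempty E] {C : ℝ} (h : ∀ u, G.MemH1Real u → G.integral u = 0 →
    C * (G.integral fun e x => u e x ^ 2) ≤ G.integral fun e x => deriv (u e) x ^ 2) :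
    C ≤ G.lambda2 := by
  obtain ⟨r, hr, hr0, hrm⟩ := G.exists_memH1Real
  refine le_csInf ⟨_, fun e x => (r e x : ℂ), hr.ofReal, by rwa [mass_ofReal], by
    rw [integral_ofReal, hr0, Complex.ofReal_zero], rfl⟩ ?_
  rintro _ ⟨φ, hφ, hm, h0, rfl⟩
  rw [le_div_iff₀ ((mass_nonneg φ).lt_of_ne' hm), hφ.mass_eq, hφ.dirichlet_eq, mul_add]
  refine add_le_add (h _ hφ.re ?_) (h _ hφ.im ?_)
  · rw [re_integral hφ.continuousOn, h0, Complex.zero_re]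
  · rw [im_integral hφ.continuousOn, h0, Complex.zero_im]

theorem exists_real_of_lambda2_lt [Nonempty E] {C : ℝ} (h : G.lambda2 < C) :
    ∃ r, G.MemH1Real r ∧ G.integral r = 0 ∧ 0 < (G.integral fun e x => r e x ^ 2) ∧
      (G.integral fun e x => deriv (r e) x ^ 2) < C * (G.integral fun e x => r e x ^ 2) := by
  by_contra! hcon
  refine h.not_ge (le_lambda2 fun u hu hu0 => ?_)
  rcases (integral_nonneg (G := G) (u := fun e x => u e x ^ 2) fun _ _ => sq_nonneg _).eq_or_lt
    with h | h
  · rw [← h, mul_zero]; exact integral_nonneg fun _ _ => sq_nonneg _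
  · exact hcon u hu hu0 h

theorem sq_pi_div_length_le_lambda2 [Nonempty E] (G : MetricGraph V E) :
    (Real.pi / G.length) ^ 2 ≤ G.lambda2 := le_lambda2 fun _ hu h0 => poincare hu h0

theorem HasCycleCovering.sq_le_lambda2 [Nonempty E] (hG : G.HasCycleCovering) :
    (2 * Real.pi / G.length) ^ 2 ≤ G.lambda2 := le_lambda2 fun _ hu h0 => hG.poincare hu h0

theorem lambda2_pos [Nonempty E] (G : MetricGraph V E) : 0 < G.lambda2 := by
  have := G.length_pos
  have := Real.pi_pos
  exact lt_of_lt_of_le (by positivity) G.sq_pi_div_length_le_lambda2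

theorem mu1_six [Nonempty E] (G : MetricGraph V E) : G.mu1 6 = G.length * √(G.lambda2) / 2 := by
  have h : G.lambda2 / (6 - 2) = G.lambda2 / 2 ^ 2 := by norm_num
  rw [mu1, h, show (2 : ℝ) / (6 - 2) = 1 / 2 by norm_num, ← Real.sqrt_eq_rpow,
    Real.sqrt_div G.lambda2_pos.le, Real.sqrt_sq two_pos.le, mul_div_assoc]

theorem pi_div_two_le_mu1 [Nonempty E] (G : MetricGraph V E) : Real.pi / 2 ≤ G.mu1 6 := by
  have hL := G.length_pos
  have := Real.le_sqrt_of_sq_le G.sq_pi_div_length_le_lambda2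
  rw [div_le_iff₀' hL] at this
  rw [mu1_six]; linarith

theorem HasCycleCovering.pi_le_mu1 [Nonempty E] (hG : G.HasCycleCovering) :
    Real.pi ≤ G.mu1 6 := by
  have hL := G.length_pos
  have := Real.le_sqrt_of_sq_le hG.sq_le_lambda2
  rw [div_le_iff₀' hL] at this
  rw [mu1_six]; linarith

end MetricGraph

/-! ### Energy near the constants: local minimality below the threshold, failure above it. -/

theorem MemH1Interval.const_add_mul {r : ℝ → ℝ} {ℓ : ℝ} (hr : MemH1Interval r ℓ) (b s : ℝ) :
    MemH1Interval (fun x => b + s * r x) ℓ := by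
  have hd : deriv (fun x => b + s * r x) = fun x => s * deriv r x := by
    ext x; rw [deriv_const_add, deriv_const_mul_field]
  refine ⟨(contDiff_const.contDiffOn.absolutelyContinuousOnInterval).add (hr.1.const_mul s), ?_⟩
  rw [hd]
  exact hr.2.const_mul s

namespace MetricGraph

variable {V E : Type*} {G : MetricGraph V E}

theorem MemH1Real.const_add_mul {r : E → ℝ → ℝ} (hr : G.MemH1Real r) (b s : ℝ) :
    G.MemH1Real fun e x => b + s * r e x := by
  obtain ⟨h, c, hc⟩ := hr
  exact ⟨fun e => (h e).const_add_mul b s, fun v => b + s * c v, fun e => by simp [hc e]⟩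

theorem MemH1.sub_const {u : E → ℝ → ℂ} (hu : G.MemH1 u) (a : ℂ) :
    G.MemH1 fun e x => u e x - a := by
  obtain ⟨h, c, hc⟩ := hu
  refine ⟨fun e => ⟨(h e).1.sub contDiff_const.contDiffOn.absolutelyContinuousOnInterval, ?_⟩,
    fun v => c v - a, fun e => by simp [hc e]⟩
  have : deriv (fun x => u e x - a) = deriv (u e) := by ext x; rw [deriv_sub_const_fun]
  rw [this]
  exact (h e).2

variable [Fintype E]

theorem dirichlet_sub_const (u : E → ℝ → ℂ) (a : ℂ) :
    G.dirichlet (fun e x => u e x - a) = G.dirichlet u := by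
  simp [dirichlet]

theorem energy_six (u : E → ℝ → ℂ) :
    G.energy 6 u = 1 / 2 * G.dirichlet u - 1 / 6 * G.integral fun e x => ‖u e x‖ ^ 6 := by
  rw [energy]
  congr 3; ext e x
  exact_mod_cast Real.rpow_natCast ‖u e x‖ 6

section Kappa

variable (G)

theorem memH1_kappa (μ : ℝ) : G.MemH1 (G.kappa μ) :=
  MemH1Real.ofReal ⟨fun _ => memH1Interval_of_contDiff contDiff_const _,
    fun _ => √(μ / G.length), fun _ => ⟨rfl, rfl⟩⟩

theorem memH1Mass_kappa [Nonempty E] {μ : ℝ} (hμ : 0 ≤ μ) : G.MemH1Mass μ (G.kappa μ) := by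
  have hL := G.length_pos
  refine ⟨G.memH1_kappa μ, ?_⟩
  simp only [mass, kappa, Complex.norm_real, Real.norm_eq_abs, sq_abs]
  rw [integral_const, Real.sq_sqrt (by positivity), smul_eq_mul]
  field_simp

theorem energy_kappa [Nonempty E] {μ : ℝ} (hμ : 0 ≤ μ) :
    G.energy 6 (G.kappa μ) = - (1 / 6 * (G.length * (μ / G.length) ^ 3)) := by
  have hL := G.length_pos
  have h0 : ∀ e x, deriv (G.kappa μ e) x = 0 := fun _ _ => deriv_const _ _
  have h1 : G.dirichlet (G.kappa μ) = 0 := by simp [dirichlet, h0, integral]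
  have h2 : ∀ x : ℝ, |x| ^ 6 = (x ^ 2) ^ 3 := fun x => by rw [← sq_abs]; ring
  rw [energy_six, h1]
  simp only [kappa, Complex.norm_real, Real.norm_eq_abs, h2]
  rw [Real.sq_sqrt (by positivity), integral_const, smul_eq_mul]
  ring

end Kappa

theorem MemH1.norm_sub_sq_le {f : E → ℝ → ℂ} (hf : G.MemH1 f) (e : E) {x y : ℝ} (hx : 0 ≤ x)
    (hxy : x ≤ y) (hy : y ≤ G.len e) : ‖f e x - f e y‖ ^ 2 ≤ G.len e * G.dirichlet f := by
  have hre := (hf.re.1 e).sq_sub_le hx hxy hy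
  have him := (hf.im.1 e).sq_sub_le hx hxy hy
  have hint : IntervalIntegrable (fun t => ‖deriv (f e) t‖ ^ 2) volume 0 (G.len e) := by
    rw [intervalIntegrable_iff_integrableOn_Ioc_of_le (G.len_pos e).le]
    exact (hf.1 e).2.norm.integrable_sq
  have h1 : ∫ t in x..y, ‖deriv (f e) t‖ ^ 2 ≤ ∫ t in (0 : ℝ)..G.len e, ‖deriv (f e) t‖ ^ 2 :=
    intervalIntegral.integral_mono_interval hx hxy hy (Eventually.of_forall fun _ => sq_nonneg _)
      hint
  have h2 : ∫ t in (0 : ℝ)..G.len e, ‖deriv (f e) t‖ ^ 2 ≤ G.dirichlet f :=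
    Finset.single_le_sum (f := fun e => ∫ t in (0 : ℝ)..G.len e, ‖deriv (f e) t‖ ^ 2)
      (fun e _ => intervalIntegral.integral_nonneg (G.len_pos e).le fun _ _ => sq_nonneg _)
      (Finset.mem_univ e)
  have h3 : 0 ≤ ∫ t in x..y, ‖deriv (f e) t‖ ^ 2 :=
    intervalIntegral.integral_nonneg hxy fun _ _ => sq_nonneg _
  calc ‖f e x - f e y‖ ^ 2 = ((f e x).re - (f e y).re) ^ 2 + ((f e x).im - (f e y).im) ^ 2 := by
        rw [Complex.sq_norm, Complex.normSq_apply, Complex.sub_re, Complex.sub_im]; ring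
    _ ≤ (y - x) * ∫ t in x..y, ‖deriv (f e) t‖ ^ 2 := by
        rw [integral_norm_deriv_sq hx hxy hy (hf.1 e).1 (hf.1 e).2, mul_add]
        exact add_le_add hre him
    _ ≤ G.len e * G.dirichlet f := by
        refine mul_le_mul (by linarith) (h1.trans h2) h3 (G.len_pos e).le

/-- The embedding of `H¹` in the continuous functions. -/
theorem exists_norm_le_mul_normH1 (G : MetricGraph V E) :
    ∃ B : ℝ, 0 < B ∧ ∀ f, G.MemH1 f → ∀ e, ∀ x ∈ Icc 0 (G.len e), ‖f e x‖ ≤ B * G.normH1 f := by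
  set b : E → ℝ := fun e => √(G.len e) + 1 / √(G.len e) with hb
  have hbpos : ∀ e, 0 < b e := fun e => by
    have := Real.sqrt_pos.2 (G.len_pos e)
    positivity
  refine ⟨1 + ∑ e, b e, by have := Finset.sum_nonneg fun e (_ : e ∈ Finset.univ) => (hbpos e).le
                           linarith, fun f hf e x hx => ?_⟩
  have hℓ := G.len_pos e
  have hsq := Real.sqrt_pos.2 hℓ
  -- At a minimum y of |f| on the edge the mass controls |f(y)|; the Dirichlet integral controls the
  -- oscillation from y to x.
  obtain ⟨y, hy, hmin⟩ := isCompact_Icc.exists_isMinOn (nonempty_Icc.2 hℓ.le)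
    (hf.continuousOn e).norm
  have hmass : G.len e * ‖f e y‖ ^ 2 ≤ G.mass f := by
    have h1 : G.len e * ‖f e y‖ ^ 2 ≤ ∫ t in (0 : ℝ)..G.len e, ‖f e t‖ ^ 2 := by
      have : G.len e * ‖f e y‖ ^ 2 = ∫ t in (0 : ℝ)..G.len e, ‖f e y‖ ^ 2 := by simp
      rw [this]
      refine intervalIntegral.integral_mono_on hℓ.le (by simp)
        (ContinuousOn.intervalIntegrable ?_) fun t ht => ?_
      · rw [uIcc_of_le hℓ.le]; exact (hf.continuousOn e).norm.pow 2
      · exact pow_le_pow_left₀ (norm_nonneg _) (hmin ht) 2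
    exact h1.trans (Finset.single_le_sum (f := fun e => ∫ t in (0 : ℝ)..G.len e, ‖f e t‖ ^ 2)
      (fun e _ => intervalIntegral.integral_nonneg (G.len_pos e).le fun _ _ => sq_nonneg _)
      (Finset.mem_univ e))
  have hy' : ‖f e y‖ ≤ 1 / √(G.len e) * √(G.mass f) := by
    have := Real.sqrt_le_sqrt hmass
    rw [Real.sqrt_mul hℓ.le, Real.sqrt_sq (norm_nonneg _)] at this
    rw [one_div, ← div_eq_inv_mul, le_div_iff₀ hsq]
    linarith
  have hd : ‖f e x - f e y‖ ≤ √(G.len e) * √(G.dirichlet f) := by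
    rw [← Real.sqrt_mul hℓ.le]
    refine Real.le_sqrt_of_sq_le ?_
    rcases le_total x y with h | h
    · exact hf.norm_sub_sq_le e hx.1 h hy.2
    · rw [norm_sub_rev]; exact hf.norm_sub_sq_le e hy.1 h hx.2
  have htri : ‖f e x‖ ≤ ‖f e x - f e y‖ + ‖f e y‖ := by
    simpa using norm_add_le (f e x - f e y) (f e y)
  have hbe : b e ≤ 1 + ∑ e, b e := by
    have := Finset.single_le_sum (fun e _ => (hbpos e).le) (Finset.mem_univ e)
    linarith
  have hn : 0 ≤ G.normH1 f := add_nonneg (Real.sqrt_nonneg _) (Real.sqrt_nonneg _)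
  refine le_trans ?_ (mul_le_mul_of_nonneg_right hbe hn)
  have i1 : 0 ≤ 1 / √(G.len e) * √(G.dirichlet f) := by positivity
  have i2 : 0 ≤ √(G.len e) * √(G.mass f) := by positivity
  simp only [hb, normH1]
  nlinarith

/-- Decomposition of the mass of `a + w` when `w` has zero mean. -/
theorem MemH1.mass_const_add {w : E → ℝ → ℂ} (hw : G.MemH1 w) (h0 : G.integral w = 0) (a : ℂ) :
    (G.integral fun e x => ‖a + w e x‖ ^ 2 - ‖a‖ ^ 2) = G.mass w := by
  have hc := hw.continuousOn
  have e1 : (fun e x => ‖a + w e x‖ ^ 2 - ‖a‖ ^ 2) = fun e x =>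
      (2 * a.re * (w e x).re + 2 * a.im * (w e x).im) + ‖w e x‖ ^ 2 := by
    ext e x
    simp only [Complex.sq_norm, Complex.normSq_apply, Complex.add_re, Complex.add_im]; ring
  have hre := hw.re.continuousOn
  have him := hw.im.continuousOn
  rw [e1, integral_add, integral_add, integral_const_mul, integral_const_mul, re_integral hc,
    im_integral hc, h0, mass]
  · simp
  all_goals
    intro e
    have h1 := hre e
    have h2 := him e
    have h3 := (hc e).norm
    fun_prop

/-- Put g = |a + w|² - |a|² and expand (|a|² + g)³. The term linear in g is kept, since its integral
is known exactly; g² and g³ are bounded by multiples of |w|². -/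
theorem norm_add_pow_six_le {a w : ℂ} {η : ℝ} (hw : ‖w‖ ≤ η) :
    ‖a + w‖ ^ 6 ≤ ‖a‖ ^ 6 + 3 * ‖a‖ ^ 4 * (‖a + w‖ ^ 2 - ‖a‖ ^ 2)
      + (3 * ‖a‖ ^ 2 * (2 * ‖a‖ + η) ^ 2 + η * (2 * ‖a‖ + η) ^ 3) * ‖w‖ ^ 2 := by
  have hA := norm_nonneg a
  have hW := norm_nonneg w
  have hη := hW.trans hw
  have hg : |‖a + w‖ ^ 2 - ‖a‖ ^ 2| ≤ ‖w‖ * (2 * ‖a‖ + ‖w‖) := by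
    have h1 := norm_add_le a w
    have h2 : |‖a + w‖ - ‖a‖| ≤ ‖w‖ := by
      simpa using abs_norm_sub_norm_le (a + w) a
    rw [sq_sub_sq, abs_mul, mul_comm, abs_of_nonneg (add_nonneg (norm_nonneg _) hA)]
    exact mul_le_mul h2 (by linarith) (by positivity) hW
  set g := ‖a + w‖ ^ 2 - ‖a‖ ^ 2 with hgdef
  have hg2 : |g| ≤ ‖w‖ * (2 * ‖a‖ + η) := hg.trans (by gcongr)
  have hg3 : |g| ≤ η * (2 * ‖a‖ + η) := hg2.trans (by gcongr)
  have hsq : g ^ 2 ≤ (2 * ‖a‖ + η) ^ 2 * ‖w‖ ^ 2 := by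
    rw [← sq_abs, ← mul_pow]
    exact pow_le_pow_left₀ (abs_nonneg _) (by linarith) 2
  have hcube : g ^ 3 ≤ η * (2 * ‖a‖ + η) * ((2 * ‖a‖ + η) ^ 2 * ‖w‖ ^ 2) := by
    calc g ^ 3 = g * g ^ 2 := by ring
      _ ≤ |g| * g ^ 2 := mul_le_mul_of_nonneg_right (le_abs_self g) (sq_nonneg g)
      _ ≤ _ := mul_le_mul hg3 hsq (sq_nonneg g) (by positivity)
  have e : ‖a + w‖ ^ 6 = (‖a‖ ^ 2 + g) ^ 3 := by rw [hgdef]; ring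
  rw [e]
  have := mul_le_mul_of_nonneg_left hsq (by positivity : 0 ≤ 3 * ‖a‖ ^ 2)
  nlinarith

theorem isLocalMinimizer_kappa [Nonempty E] {μ : ℝ} (hμ : 0 < μ) (h : μ < G.mu1 6) :
    G.IsLocalMinimizer 6 μ (G.kappa μ) := by
  have hL := G.length_pos
  set K := √(μ / G.length) with hK
  have hK0 : 0 ≤ K := Real.sqrt_nonneg _
  have hK2 : K ^ 2 = μ / G.length := Real.sq_sqrt (by positivity)
  have hlam : 4 * (K ^ 2) ^ 2 < G.lambda2 := by
    rw [mu1_six] at h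
    have h1 : 2 * K ^ 2 < √(G.lambda2) := by
      rw [hK2, mul_div_assoc', div_lt_iff₀ hL]; linarith
    have h2 := pow_lt_pow_left₀ h1 (by positivity) two_ne_zero
    rw [Real.sq_sqrt G.lambda2_pos.le] at h2
    linarith
  -- At η = 0 the left side is 12K⁴ < 3λ₂. The extra 3K²η² will absorb the t² term of (K² - t)³.
  obtain ⟨η, hη, hρ⟩ : ∃ η : ℝ, 0 < η ∧ 3 * K ^ 2 * η ^ 2 +
      (3 * K ^ 2 * (2 * K + η) ^ 2 + η * (2 * K + η) ^ 3) < 3 * G.lambda2 := by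
    have hcont : Continuous fun η : ℝ => 3 * K ^ 2 * η ^ 2 +
      (3 * K ^ 2 * (2 * K + η) ^ 2 + η * (2 * K + η) ^ 3) := by fun_prop
    have hev := (hcont.tendsto 0).eventually_lt_const (u := 3 * G.lambda2) (by nlinarith)
    obtain ⟨η, hη, h⟩ := ((hev.filter_mono nhdsWithin_le_nhds).and
      (self_mem_nhdsWithin (s := Ioi (0 : ℝ)))).exists
    exact ⟨η, h, hη⟩
  obtain ⟨B, hB, hsup⟩ := G.exists_norm_le_mul_normH1
  -- This radius makes |v - K| ≤ η/2 uniformly, hence also |a - K| ≤ η/2 and |w| ≤ η.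
  refine ⟨G.memH1Mass_kappa hμ.le, η / (2 * B), by positivity, fun v ⟨hv, hvm⟩ hδ => ?_⟩
  set a : ℂ := G.length⁻¹ • G.integral v with ha
  set w : E → ℝ → ℂ := fun e x => v e x - a with hw
  have hwH : G.MemH1 w := hv.sub_const a
  have hvw : ∀ e x, v e x = a + w e x := fun e x => by simp [hw]
  have hw0 : G.integral w = 0 := by
    have := integral_add (G := G) (u := v) (v := fun _ _ => -a) hv.continuousOn
      fun _ => continuousOn_const
    have haL : G.length • a = G.integral v := by rw [ha, smul_inv_smul₀ hL.ne']
    rw [integral_const, smul_neg, haL, add_neg_cancel] at this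
    rw [← this]
    simp only [hw, sub_eq_add_neg]
  have hf : ∀ e, ∀ x ∈ Icc 0 (G.len e), ‖v e x - K‖ ≤ η / 2 := by
    intro e x hx
    refine (hsup _ (hv.sub_const K) e x hx).trans ?_
    have : B * G.normH1 (v - G.kappa μ) ≤ B * (η / (2 * B)) := by gcongr
    refine this.trans (le_of_eq (by field_simp))
  have hmean : ‖a - K‖ ≤ η / 2 := by
    have h1 := norm_integral_le hf
    have h2 := integral_add (G := G) (u := v) (v := fun _ _ => -(K : ℂ)) hv.continuousOn
      fun _ => continuousOn_const
    rw [integral_const] at h2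
    simp only [← sub_eq_add_neg] at h2
    have h3 : a - K = G.length⁻¹ • G.integral fun e x => v e x - K := by
      rw [h2, smul_add, inv_smul_smul₀ hL.ne', ha, sub_eq_add_neg]
    rw [h3, norm_smul, Real.norm_eq_abs, abs_of_pos (inv_pos.2 hL), inv_mul_le_iff₀ hL]
    linarith
  have hwη : ∀ e, ∀ x ∈ Icc 0 (G.len e), ‖w e x‖ ≤ η := by
    intro e x hx
    have : w e x = (v e x - K) - (a - K) := by simp [hw]
    rw [this]
    have := norm_sub_le (v e x - K) (a - K)
    linarith [hf e x hx]
  have hwc := hwH.continuousOn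
  have hvc := hv.continuousOn
  have hmass := hwH.mass_const_add hw0 a
  simp only [← hvw] at hmass
  have hsplit : μ = ‖a‖ ^ 2 * G.length + G.mass w := by
    have := integral_add (G := G) (u := fun e x => ‖v e x‖ ^ 2) (v := fun _ _ => -‖a‖ ^ 2)
      (fun e => (hvc e).norm.pow 2) fun _ => continuousOn_const
    simp only [← sub_eq_add_neg] at this
    rw [hmass, integral_const, ← mass, hvm, smul_eq_mul] at this
    linarith
  have hmη : G.mass w ≤ η ^ 2 * G.length := by
    have := norm_integral_le (G := G) (u := fun e x => ‖w e x‖ ^ 2) (C := η ^ 2) fun e x hx => by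
      rw [norm_pow, norm_norm]
      exact pow_le_pow_left₀ (norm_nonneg _) (hwη e x hx) 2
    exact (Real.le_norm_self _).trans this
  set c := 3 * ‖a‖ ^ 2 * (2 * ‖a‖ + η) ^ 2 + η * (2 * ‖a‖ + η) ^ 3 with hc
  have hsix : (G.integral fun e x => ‖v e x‖ ^ 6) ≤
      G.length * ‖a‖ ^ 6 + 3 * ‖a‖ ^ 4 * G.mass w + c * G.mass w := by
    have h1 : (G.integral fun e x => ‖v e x‖ ^ 6) ≤ G.integral fun e x =>
        (‖a‖ ^ 6 + 3 * ‖a‖ ^ 4 * (‖v e x‖ ^ 2 - ‖a‖ ^ 2)) + c * ‖w e x‖ ^ 2 := by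
      refine integral_mono (fun e => (hvc e).norm.pow 6) (fun e => ?_) fun e x hx => ?_
      · have h1 := (hvc e).norm
        have h2 := (hwc e).norm
        fun_prop
      · have := norm_add_pow_six_le (a := a) (hwη e x hx)
        rwa [← hvw] at this
    refine h1.trans (le_of_eq ?_)
    rw [integral_add, integral_add, integral_const, integral_const_mul, integral_const_mul, hmass,
      mass, smul_eq_mul]
    · exact fun _ => continuousOn_const
    · intro e
      have h1 := (hvc e).norm
      fun_prop
    · intro e
      have h1 := (hvc e).norm
      fun_prop
    · intro e
      have h2 := (hwc e).norm
      fun_prop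
  have hD : G.lambda2 * G.mass w ≤ G.dirichlet v := by
    rw [← dirichlet_sub_const v a]
    exact hwH.lambda2_mul_mass_le hw0
  rw [energy_kappa G hμ.le, energy_six, ← hK2]
  have hm0 := mass_nonneg (G := G) w
  -- t is the mass of w per unit length, so that conservation of mass reads |a|² = K² - t.
  obtain ⟨t, ht⟩ : ∃ t, G.mass w = t * G.length := ⟨G.mass w / G.length, by field_simp⟩
  have ht0 : 0 ≤ t := by
    rw [ht] at hm0; exact nonneg_of_mul_nonneg_left hm0 hL
  have htη : t ≤ η ^ 2 := by
    rw [ht] at hmη; exact le_of_mul_le_mul_right hmη hL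
  have hAK : ‖a‖ ^ 2 = K ^ 2 - t := by
    rw [hK2, eq_sub_iff_add_eq, eq_div_iff hL.ne', hsplit, ht]; ring
  have hA0 := norm_nonneg a
  have hAle : ‖a‖ ≤ K := by
    refine le_of_sq_le_sq ?_ hK0
    linarith
  have hcK : c ≤ 3 * K ^ 2 * (2 * K + η) ^ 2 + η * (2 * K + η) ^ 3 := by
    rw [hc]; gcongr
  have hA4 : ‖a‖ ^ 4 ≤ K ^ 4 := pow_le_pow_left₀ hA0 hAle 4
  have hA6 : ‖a‖ ^ 6 = (K ^ 2 - t) ^ 3 := by rw [← hAK]; ring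
  have hA6' : ‖a‖ ^ 6 ≤ K ^ 6 - 3 * K ^ 4 * t + 3 * K ^ 2 * η ^ 2 * t := by
    rw [hA6]
    have h1 : 3 * K ^ 2 * (t * t) ≤ 3 * K ^ 2 * (η ^ 2 * t) := by gcongr
    have h2 : 0 ≤ t ^ 3 := by positivity
    nlinarith
  -- The loss -3K⁴ ∫|w|² coming from |a|⁶ cancels the linear term 3|a|⁴ ∫|w|², bounded by 3K⁴ ∫|w|²;
  -- what remains is governed by the choice of η.
  have key : G.length * ‖a‖ ^ 6 + 3 * ‖a‖ ^ 4 * G.mass w + c * G.mass w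
      ≤ G.length * (K ^ 2) ^ 3 + 3 * G.lambda2 * G.mass w := by
    have h1 := mul_le_mul_of_nonneg_left hA6' hL.le
    have h2 := mul_le_mul_of_nonneg_right hA4 hm0
    have h3 := mul_le_mul_of_nonneg_right hcK hm0
    have h4 := mul_le_mul_of_nonneg_right hρ.le hm0
    have h5 : G.length * (K ^ 6 - 3 * K ^ 4 * t + 3 * K ^ 2 * η ^ 2 * t)
      = G.length * (K ^ 2) ^ 3 - 3 * (K ^ 4 * G.mass w) + 3 * K ^ 2 * η ^ 2 * G.mass w := by
      rw [ht]; ring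
    linarith
  linarith

theorem MemH1Real.integral_const_add_mul_sq {r : E → ℝ → ℝ} (hr : G.MemH1Real r)
    (h0 : G.integral r = 0) (b s : ℝ) : (G.integral fun e x => (b + s * r e x) ^ 2)
      = G.length * b ^ 2 + s ^ 2 * G.integral fun e x => r e x ^ 2 := by
  have hc := hr.continuousOn
  have e1 : (fun e x => (b + s * r e x) ^ 2) = fun e x =>
      (b ^ 2 + 2 * b * s * r e x) + s ^ 2 * r e x ^ 2 := by ext e x; ring
  rw [e1, integral_add, integral_add, integral_const, integral_const_mul, integral_const_mul, h0]
  · simp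
  all_goals
    intro e
    have := hc e
    fun_prop

theorem MemH1Real.integral_const_add_mul_pow_six {r : E → ℝ → ℝ} (hr : G.MemH1Real r)
    (h0 : G.integral r = 0) (b s : ℝ) : (G.integral fun e x => (b + s * r e x) ^ 6)
      = G.length * b ^ 6 + 15 * b ^ 4 * s ^ 2 * (G.integral fun e x => r e x ^ 2)
        + 20 * b ^ 3 * s ^ 3 * (G.integral fun e x => r e x ^ 3)
        + 15 * b ^ 2 * s ^ 4 * (G.integral fun e x => r e x ^ 4)
        + 6 * b * s ^ 5 * (G.integral fun e x => r e x ^ 5)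
        + s ^ 6 * (G.integral fun e x => r e x ^ 6) := by
  have hc := hr.continuousOn
  have e1 : (fun e x => (b + s * r e x) ^ 6) = fun e x =>
      (((((b ^ 6 + 6 * b ^ 5 * s * r e x) + 15 * b ^ 4 * s ^ 2 * r e x ^ 2)
        + 20 * b ^ 3 * s ^ 3 * r e x ^ 3) + 15 * b ^ 2 * s ^ 4 * r e x ^ 4)
        + 6 * b * s ^ 5 * r e x ^ 5) + s ^ 6 * r e x ^ 6 := by ext e x; ring
  rw [e1, integral_add, integral_add, integral_add, integral_add, integral_add, integral_add]
  · simp only [integral_const, integral_const_mul, h0]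
    simp
  all_goals
    intro e
    have := hc e
    fun_prop

theorem not_isLocalMinimizer_kappa [Nonempty E] {μ : ℝ} (h : G.mu1 6 < μ) :
    ¬ G.IsLocalMinimizer 6 μ (G.kappa μ) := by
  have hL := G.length_pos
  have hμ : 0 < μ := (Real.pi_div_two_pos.trans_le G.pi_div_two_le_mu1).trans h
  set K := √(μ / G.length) with hK
  have hK0 : 0 ≤ K := Real.sqrt_nonneg _
  have hK2 : K ^ 2 = μ / G.length := Real.sq_sqrt (by positivity)
  have hlam : G.lambda2 < 4 * K ^ 4 := by
    rw [mu1_six] at h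
    have h1 : √(G.lambda2) < 2 * K ^ 2 := by
      rw [hK2, mul_div_assoc', lt_div_iff₀ hL]; linarith
    have h2 := pow_lt_pow_left₀ h1 (Real.sqrt_nonneg _) two_ne_zero
    rw [Real.sq_sqrt G.lambda2_pos.le] at h2
    linarith
  obtain ⟨r, hr, h0, hm, hD⟩ := exists_real_of_lambda2_lt hlam
  set m := G.integral fun e x => r e x ^ 2 with hmdef
  set D := G.integral fun e x => deriv (r e) x ^ 2 with hDdef
  set I₃ := G.integral fun e x => r e x ^ 3 with hI3
  set I₄ := G.integral fun e x => r e x ^ 4 with hI4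
  set I₅ := G.integral fun e x => r e x ^ 5 with hI5
  set I₆ := G.integral fun e x => r e x ^ 6 with hI6
  rintro ⟨-, δ, hδ, hmin⟩
  -- The constant part that keeps the mass of b(s) + s r equal to μ.
  set b : ℝ → ℝ := fun s => K * √(1 - s ^ 2 * m / μ) with hb
  have hbc : Continuous b := by fun_prop
  have hb0 : b 0 = K := by simp [hb]
  -- The energy difference divided by s²; its value at 0 is D/2 - 2K⁴m, negative by the choice of r.
  set Q : ℝ → ℝ := fun s => 1 / 2 * D - 1 / 6 * (-(K ^ 4 * m * (3 - 3 * (s ^ 2 * m / μ)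
    + (s ^ 2 * m / μ) ^ 2)) + 15 * b s ^ 4 * m + s * (20 * b s ^ 3 * I₃ + 15 * b s ^ 2 * s * I₄
    + 6 * b s * s ^ 2 * I₅ + s ^ 3 * I₆)) with hQ
  have hQc : Continuous Q := by fun_prop
  have hQ0 : Q 0 < 0 := by simp only [hQ, hb0]; norm_num; linarith
  set n : ℝ → ℝ := fun s => √(s ^ 2 * D) + √(G.length * (b s - K) ^ 2 + s ^ 2 * m) with hn
  have hnc : Continuous n := by fun_prop
  have hn0 : n 0 < δ := by simpa [hn, hb0] using hδ
  -- For small s the radicand in b stays positive, so the square root takes no default value.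
  have hx : Continuous fun s : ℝ => s ^ 2 * m / μ := by fun_prop
  obtain ⟨s, ⟨⟨h1, h2⟩, h3⟩, hs⟩ := (((((hQc.tendsto 0).eventually_lt_const hQ0).and
    ((hnc.tendsto 0).eventually_lt_const hn0)).and ((hx.tendsto 0).eventually_lt_const
      (u := 1) (by simp))).filter_mono nhdsWithin_le_nhds |>.and
    (self_mem_nhdsWithin (s := Ioi (0 : ℝ)))).exists
  have hs : 0 < s := hs
  have hx0 : 0 ≤ 1 - s ^ 2 * m / μ := by linarith
  have hb2 : b s ^ 2 = K ^ 2 * (1 - s ^ 2 * m / μ) := by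
    simp only [hb]; rw [mul_pow, Real.sq_sqrt hx0]
  have hder : ∀ b s : ℝ, (G.integral fun e x => deriv (fun x => b + s * r e x) x ^ 2)
      = s ^ 2 * D := fun b s => by
    rw [hDdef, ← integral_const_mul]
    congr 1; ext e x
    rw [deriv_const_add, deriv_const_mul_field, mul_pow]
  have hvH := hr.const_add_mul (b s) s
  have hmass : G.mass (fun e x => ((b s + s * r e x : ℝ) : ℂ)) = μ := by
    rw [mass_ofReal, hr.integral_const_add_mul_sq h0, ← hmdef, hb2, hK2]
    field_simp; ring
  have hnorm : G.normH1 ((fun e x => ((b s + s * r e x : ℝ) : ℂ)) - G.kappa μ) < δ := by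
    have e : (fun e x => ((b s + s * r e x : ℝ) : ℂ)) - G.kappa μ
        = fun e x => (((b s - K) + s * r e x : ℝ) : ℂ) := by
      ext e x; simp [kappa, ← hK]; ring
    rw [e, normH1, mass_ofReal, (hr.const_add_mul _ _).dirichlet_ofReal, hder,
      hr.integral_const_add_mul_sq h0]
    exact h2
  have hE := hmin _ ⟨hvH.ofReal, hmass⟩ hnorm
  rw [energy_kappa G hμ.le, energy_six, hvH.dirichlet_ofReal, hder, ← hK2] at hE
  have hsix : (G.integral fun e x => ‖((b s + s * r e x : ℝ) : ℂ)‖ ^ 6)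
      = G.integral fun e x => (b s + s * r e x) ^ 6 := by
    congr 1; ext e x
    rw [Complex.norm_real, Real.norm_eq_abs, Even.pow_abs (by decide)]
  rw [hsix, hr.integral_const_add_mul_pow_six h0] at hE
  have hb6 : G.length * b s ^ 6 = G.length * (K ^ 2) ^ 3 - s ^ 2 * (K ^ 4 * m *
      (3 - 3 * (s ^ 2 * m / μ) + (s ^ 2 * m / μ) ^ 2)) := by
    have e : b s ^ 6 = (b s ^ 2) ^ 3 := by ring
    have e' : K ^ 4 = (K ^ 2) ^ 2 := by ring
    rw [e, e', hb2, hK2]; field_simp; ring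
  have hneg : s ^ 2 * Q s < 0 := mul_neg_of_pos_of_neg (by positivity) h1
  have heq : s ^ 2 * Q s = 1 / 2 * (s ^ 2 * D) - 1 / 6 * (G.length * b s ^ 6
      + 15 * b s ^ 4 * s ^ 2 * m + 20 * b s ^ 3 * s ^ 3 * I₃ + 15 * b s ^ 2 * s ^ 4 * I₄
      + 6 * b s * s ^ 5 * I₅ + s ^ 6 * I₆) + 1 / 6 * (G.length * (K ^ 2) ^ 3) := by
    rw [hb6]; simp only [hQ]; ring
  linarith

end MetricGraph

theorem theorem3 {V E : Type*} [Fintype E] [Nonempty E] (G : MetricGraph V E) :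
    G.IsThreshold 6 (G.mu1 6) ∧
    Real.pi / 2 ≤ G.mu1 6 ∧
    (G.HasCycleCovering → Real.pi ≤ G.mu1 6) :=
  ⟨⟨Real.pi_div_two_pos.trans_le G.pi_div_two_le_mu1,
    fun _ hμ h => MetricGraph.isLocalMinimizer_kappa hμ h,
    fun _ h => MetricGraph.not_isLocalMinimizer_kappa h⟩,
    G.pi_div_two_le_mu1, fun hG => hG.pi_le_mu1⟩
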